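/- Let $\mathbb{K}$ be an arbitrary field. Let $\mathrm{UT}_n^{(-)}$ be the Lie algebra of upper triangular $n\times n$ matrices over $\mathbb{K}$ with bracket $[a,b]=ab-ba$, and let $\Gamma(1,1)$ be the $\mathbb{Z}_2$-grading of $\mathrm{UT}_3^{(-)}$ with $\deg e_{11}=\deg e_{22}=\deg e_{33}=\deg e_{13}=0$ and $\deg e_{12}=\deg e_{23}=1$. Let $\mathcal{L}(Y\cup Z)$ be the free $\mathbb{Z}_2$-graded Lie algebra over $\mathbb{K}$ on variables $y_1,y_2,\dots$ of degree $0$ and $z_1,z_2,\dots$ of degree $1$, and let $\mathcal{L}(Y)$ be the subalgebra generated by the $y_i$. Let $\mathrm{Id}_{\mathbb{Z}_2}(\mathrm{UT}_3^{(-)},\Gamma(1,1))$ be the ideal of those $f\in\mathcal{L}(Y\cup Z)$ that vanish under every substitution of elements of $\mathrm{UT}_3^{(-)}$ of degree $0$ for the $y_i$ and of degree $1$ for the $z_i$. Commutators are left-normed, and $[x,y^{(m)}]=[x,y,\dots,y]$ with $m$ factors $y$. A $T_{\mathbb{Z}_2}$-ideal is an ideal of $\mathcal{L}(Y\cup Z)$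 that is invariant under all graded endomorphisms. Theorem. (a) $\mathrm{Id}_{\mathbb{Z}_2}(\mathrm{UT}_3^{(-)},\Gamma(1,1))$ is generated, as a $T_{\mathbb{Z}_2}$-ideal, by (i) $[z_1,z_2,z_3]$, (ii) $[y_1,y_2,z]$, (iii) all polynomials of $\mathcal{L}(Y)$ that are ordinary polynomial identities of $\mathrm{UT}_2^{(-)}$, and, if $\mathbb{K}$ is finite with $q$ elements, additionally by (iv) $[z,y^{(q)}]-[z,y]$. (b) Let $B\subseteq\mathcal{L}(Y)$ be any set whose image is a basis of the relatively free algebra $\mathcal{L}(Y)/(\mathrm{Id}(\mathrm{UT}_2^{(-)})\cap\mathcal{L}(Y))$. Then a basis of the relatively free algebra $\mathcal{L}(Y\cup Z)/\mathrm{Id}_{\mathbb{Z}_2}(\mathrm{UT}_3^{(-)},\Gamma(1,1))$ is given by the image of the set consisting of the elements of $B$ and of all polynomials $$[z_i,y_1^{(p_1)},\dots,y_r^{(p_r)}],$$ $$[[z_i,y_1^{(p_1)},\dots,y_r^{(p_r)}],[z_j,y_1^{(q_1)},\dots,y_r^{(q_r)}]],\quad i\le j,$$ where $r\ge 0$ and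 $0\le p_\ell,q_\ell<|\mathbb{K}|$ for each $\ell\in\{1,\dots,r\}$ and where, if $i=j$ in the second family, $(p_1,\dots,p_r)<_l(q_1,\dots,q_r)$ in the lexicographic order on $\mathbb{N}_0^r$. -/

import Mathlib

attribute [local instance 100] LieRing.ofAssociativeRing

namespace GradedLiePI

noncomputable section

/-! ### The free graded Lie algebra -/

/-- The free Lie algebra `𝓛(X^G)` over `K` on the graded variables `x_{i,g}`, `i ∈ ℕ`, `g ∈ G`;
the variable `x_{i,g}` is `FreeLieAlgebra.of K (i, g)`. -/
abbrev FreeGraded (K G : Type*) [CommRing K] : Type _ := FreeLieAlgebra K (ℕ × G)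

/-- `IsMonomial m d`: the element `m` of the free Lie algebra is a Lie monomial in the graded
variables, of total degree `d`. -/
inductive IsMonomial {K G : Type*} [CommRing K] [AddCommGroup G] : FreeGraded K G → G → Prop
  | of (i : ℕ) (g : G) : IsMonomial (FreeLieAlgebra.of K (i, g)) g
  | lie {a b : FreeGraded K G} {g h : G} :
      IsMonomial a g → IsMonomial b h → IsMonomial ⁅a, b⁆ (g + h)

/-- The homogeneous component of degree `d` of the free graded Lie algebra. -/
def freeComponent (K : Type*) {G : Type*} [CommRing K] [AddCommGroup G] (d : G) :
    Submodule K (FreeGraded K G) :=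
  Submodule.span K {m | IsMonomial m d}

/-- The graded endomorphisms of the free graded Lie algebra: each variable `x_{i,g}` goes to an
element of degree `g`. -/
def IsGradedEnd {K G : Type*} [CommRing K] [AddCommGroup G]
    (φ : FreeGraded K G →ₗ⁅K⁆ FreeGraded K G) : Prop :=
  ∀ (i : ℕ) (g : G), φ (FreeLieAlgebra.of K (i, g)) ∈ freeComponent K g

/-- A `T_G`-ideal: an ideal of the free graded Lie algebra that is invariant under all graded
endomorphisms. -/
def IsTIdeal {K G : Type*} [CommRing K] [AddCommGroup G] (I : LieIdeal K (FreeGraded K G)) :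
    Prop :=
  ∀ φ : FreeGraded K G →ₗ⁅K⁆ FreeGraded K G, IsGradedEnd φ → ∀ f ∈ I, φ f ∈ I

/-- The `T_G`-ideal generated by a set `S`: the smallest `T_G`-ideal that contains `S`. -/
def tIdealSpan {K G : Type*} [CommRing K] [AddCommGroup G] (S : Set (FreeGraded K G)) :
    LieIdeal K (FreeGraded K G) :=
  sInf {I | IsTIdeal I ∧ S ⊆ I}

/-! ### Identities -/

/-- The ideal `Id(L)` of ordinary polynomial identities of a Lie algebra `L`, in the free Lie
algebra on the variables indexed by `ℕ`. -/
def identities (K L : Type*) [CommRing K] [LieRing L] [LieAlgebra K L] :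
    LieIdeal K (FreeLieAlgebra K ℕ) :=
  ⨅ σ : ℕ → L, (FreeLieAlgebra.lift K σ).ker

/-- The ideal of graded polynomial identities of a Lie algebra `L` with a family of homogeneous
components `Γ g`: the polynomials that vanish under every substitution that sends each variable
`x_{i,g}` to an element of `Γ g`. -/
def gradedIdentities {K G L : Type*} [CommRing K] [LieRing L] [LieAlgebra K L]
    (Γ : G → Submodule K L) : LieIdeal K (FreeGraded K G) :=
  ⨅ (σ : ℕ × G → L) (_ : ∀ i g, σ (i, g) ∈ Γ g), (FreeLieAlgebra.lift K σ).ker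

/-- The images of the elements of `S` form a `K`-basis of the quotient of the Lie algebra `L` by
the ideal `I`. -/
def IsBasisModulo {K L : Type*} [CommRing K] [LieRing L] [LieAlgebra K L] (I : LieIdeal K L)
    (S : Set L) : Prop :=
  LinearIndependent K (fun s : S => (LieSubmodule.Quotient.mk (s : L) : L ⧸ I)) ∧
    Submodule.span K ((fun s : L => (LieSubmodule.Quotient.mk s : L ⧸ I)) '' S) = ⊤

/-! ### Upper triangular matrices -/

/-- The Lie algebra `UT_n^{(-)}` of upper triangular `n × n` matrices, with the commutator as
bracket. -/
def UT (K : Type*) [CommRing K] (n : ℕ) : LieSubalgebra K (Matrix (Fin n) (Fin n) K) where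
  carrier := {M | M.IsUpperTriangular}
  add_mem' hM hN := hM.add hN
  zero_mem' := Matrix.blockTriangular_zero
  smul_mem' c _ hM i j hij := by simp [hM hij]
  lie_mem' hM hN := by
    rw [Ring.lie_def]
    exact (hM.mul hN).sub (hN.mul hM)

/-- The degree of the matrix unit `e_{ij}` (`i ≤ j`) in the elementary grading `Γ(g,h)` on `3 × 3`
upper triangular matrices: `deg e_{ii} = 0`, `deg e_{12} = g`, `deg e_{23} = h`,
`deg e_{13} = g + h`. -/
def unitDegree {G : Type*} [AddCommGroup G] (g h : G) (i j : Fin 3) : G :=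
  (![0, g, g + h] : Fin 3 → G) j - (![0, g, g + h] : Fin 3 → G) i

/-- The homogeneous component of degree `d` of `UT_3^{(-)}` with the elementary grading `Γ(g,h)`:
the upper triangular matrices all of whose non-zero entries are in positions of degree `d`. -/
def elementaryGrading (K : Type*) {G : Type*} [CommRing K] [AddCommGroup G] (g h d : G) :
    Submodule K (UT K 3) where
  carrier := {M | ∀ i j, (M : Matrix (Fin 3) (Fin 3) K) i j ≠ 0 → unitDegree g h i j = d}
  add_mem' {M N} hM hN i j hij := by
    by_cases h0 : (M : Matrix (Fin 3) (Fin 3) K) i j = 0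
    · refine hN i j fun h1 => hij ?_
      simp [h0, h1]
    · exact hM i j h0
  zero_mem' i j hij := absurd rfl hij
  smul_mem' c M hM i j hij := hM i j fun h0 => hij (by simp [h0])

/-- The almost canonical `ℤ₂`-grading `Γ(1,1)` on `UT_3^{(-)}`. -/
def almostCanonical (K : Type*) [CommRing K] : ZMod 2 → Submodule K (UT K 3) :=
  elementaryGrading K 1 1

/-! ### Variables and commutators -/

/-- The left-normed commutator `[x, y^{(m)}] = [x, y, …, y]` with `m` factors `y`. -/
def lieRepeat {L : Type*} [LieRing L] (x y : L) (m : ℕ) : L :=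
  (fun u => ⁅u, y⁆)^[m] x

/-- The left-normed commutator `[x, y_1^{(p_1)}, …, y_r^{(p_r)}]`, for a sequence `y` of elements
numbered from `0`. -/
def lieMulti {L : Type*} [LieRing L] (x : L) (y : ℕ → L) {r : ℕ} (p : Fin r → ℕ) : L :=
  Fin.foldl r (fun u l => lieRepeat u (y l) (p l)) x

/-- The variables `y_i` of degree `0`. -/
def yVar (K : Type*) [CommRing K] (i : ℕ) : FreeGraded K (ZMod 2) := FreeLieAlgebra.of K (i, 0)

/-- The variables `z_i` of degree `1`. -/
def zVar (K : Type*) [CommRing K] (i : ℕ) : FreeGraded K (ZMod 2) := FreeLieAlgebra.of K (i, 1)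

/-- The embedding of the free Lie algebra on `ℕ` onto `𝓛(Y)`, the subalgebra of the free
`ℤ₂`-graded Lie algebra generated by the variables `y_i` of degree `0`. -/
def inY (K : Type*) [CommRing K] : FreeLieAlgebra K ℕ →ₗ⁅K⁆ FreeGraded K (ZMod 2) :=
  FreeLieAlgebra.lift K (yVar K)

/-- The polynomials that generate the graded identities: `[z_1,z_2,z_3]`, `[y_1,y_2,z]`, the
identities of `UT_2^{(-)}` in the variables `y_i` and, if `K` is finite with `q` elements,
`[z,y^{(q)}] - [z,y]`. -/
def generators (K : Type*) [Field K] : Set (FreeGraded K (ZMod 2)) :=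
  {⁅⁅zVar K 0, zVar K 1⁆, zVar K 2⁆} ∪
  {⁅⁅yVar K 0, yVar K 1⁆, zVar K 0⁆} ∪
  inY K '' (identities K (UT K 2) : Set (FreeLieAlgebra K ℕ)) ∪
  {f | Finite K ∧ f = lieRepeat (zVar K 0) (yVar K 0) (Nat.card K) - ⁅zVar K 0, yVar K 0⁆}

/-- The polynomials `[z_i, y_1^{(p_1)}, …, y_r^{(p_r)}]` with `r ≥ 0` and `p_l < |K|`. -/
def linearPolys (K : Type*) [Field K] : Set (FreeGraded K (ZMod 2)) :=
  {f | ∃ (i r : ℕ) (p : Fin r → ℕ), (∀ l, (p l : ℕ∞) < ENat.card K) ∧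
    f = lieMulti (zVar K i) (yVar K) p}

/-- The polynomials `[[z_i, y_1^{(p_1)}, …, y_r^{(p_r)}], [z_j, y_1^{(q_1)}, …, y_r^{(q_r)}]]` with
`i ≤ j`, `r ≥ 0`, `p_l, q_l < |K|` and, when `i = j`, `(p_1, …, p_r)` lexicographically smaller
than `(q_1, …, q_r)`. -/
def quadraticPolys (K : Type*) [Field K] : Set (FreeGraded K (ZMod 2)) :=
  {f | ∃ (i j r : ℕ) (p q : Fin r → ℕ), i ≤ j ∧
    (∀ l, (p l : ℕ∞) < ENat.card K) ∧ (∀ l, (q l : ℕ∞) < ENat.card K) ∧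
    (i = j → toLex p < toLex q) ∧
    f = ⁅lieMulti (zVar K i) (yVar K) p, lieMulti (zVar K j) (yVar K) q⁆}

end

end GradedLiePI

/-!
The ideal `Id` of graded identities contains the `T`-ideal `T` of the generators, because `Id` is
itself a `T`-ideal and each generator vanishes on `UT_3^{(-)}`. The converse inclusion and the basis
both follow from a normal form modulo `T` that evaluations show to be unique modulo `Id`.

*Spanning* (`OddRelations.span_eq_top`, `exists_decomposition`). Modulo `T`, brackets with the
`y_l` commute with each other on elements of degree one, and over a field with `q` elements the
`q`-th power of such a bracket equals the bracket itself; so a bracket of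
`[z_i, y_1^{(p_1)}, …, y_r^{(p_r)}]` with some `y_l` is again of this form, with exponents smaller
than `|K|`. The brackets of two of these commutators are annihilated by every `z_j`, by
`[z_1, z_2, z_3]`, and brackets with `y_l` only yield sums of such brackets, by the Leibniz rule.
Hence `𝓛(Y)`, these commutators, and their brackets together span an ideal that contains all
variables.

*Uniqueness* (`decomposition_unique`). Three linear maps vanish on `Id` and separate the three types
of elements.
* Sending all `z_i` to zero maps `Id` to the identities of `UT_2^{(-)}`, because `UT_2^{(-)}` sits
  in degree zero as the matrices whose second row and column vanish.
* Substituting diagonal matrices for the `y_l` and `x_i e_{12} + x'_i e_{23}` for the `z_i` makes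
  the `e_{12}`-coefficient of a commutator the function `x_i a_1^{p_1} ⋯ a_r^{p_r}`. As all exponents
  are smaller than `|K|`, these functions are linearly independent
  (`linearIndependent_commValue`).
* Under the same substitutions the `e_{13}`-coefficient of a bracket of two commutators is an
  alternating product of two such functions in separate variables, and these are linearly
  independent, too, if one takes each pair in one order only (`linearIndependent_pairValue`).

The degree zero component of `UT_3^{(-)}` satisfies the same identities as `UT_2^{(-)}`, since it is
embedded into a product of two copies of `UT_2^{(-)}` by `evenCorner` and `evenCentre`; this gives
the generators in `𝓛(Y)`.
-/

namespace GradedLiePI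

noncomputable section

/-! ### Left-normed commutators -/

section Commutators

variable {L : Type*} [LieRing L]

@[simp]
theorem lieRepeat_zero (x y : L) : lieRepeat x y 0 = x := rfl

theorem lieRepeat_succ (x y : L) (m : ℕ) : lieRepeat x y (m + 1) = ⁅lieRepeat x y m, y⁆ :=
  Function.iterate_succ_apply' _ _ _

theorem lieRepeat_add (x y : L) (m n : ℕ) :
    lieRepeat x y (m + n) = lieRepeat (lieRepeat x y n) y m :=
  Function.iterate_add_apply _ _ _ _

@[simp]
theorem lieMulti_zero (x : L) (y : ℕ → L) (p : Fin 0 → ℕ) : lieMulti x y p = x :=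
  Fin.foldl_zero _ _

theorem lieMulti_succ (x : L) (y : ℕ → L) {r : ℕ} (p : Fin (r + 1) → ℕ) :
    lieMulti x y p =
      lieRepeat (lieMulti x y fun l : Fin r => p l.castSucc) (y r) (p (Fin.last r)) := by
  simp [lieMulti, Fin.foldl_succ_last]

theorem map_lieRepeat {K L' : Type*} [CommRing K] [LieAlgebra K L] [LieRing L'] [LieAlgebra K L']
    (φ : L →ₗ⁅K⁆ L') (x y : L) (m : ℕ) : φ (lieRepeat x y m) = lieRepeat (φ x) (φ y) m := by
  induction m with
  | zero => rfl
  | succ m ih => rw [lieRepeat_succ, lieRepeat_succ, LieHom.map_lie, ih]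

theorem map_lieMulti {K L' : Type*} [CommRing K] [LieAlgebra K L] [LieRing L'] [LieAlgebra K L']
    (φ : L →ₗ⁅K⁆ L') (x : L) (y : ℕ → L) {r : ℕ} (p : Fin r → ℕ) :
    φ (lieMulti x y p) = lieMulti (φ x) (φ ∘ y) p := by
  induction r with
  | zero => simp
  | succ r ih => rw [lieMulti_succ, lieMulti_succ, map_lieRepeat, ih]; rfl

theorem lieMulti_eq_of_le (x : L) (y : ℕ → L) (p : ℕ → ℕ) {r s : ℕ} (hrs : r ≤ s)
    (hp : ∀ l, r ≤ l → p l = 0) :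
    lieMulti x y (fun l : Fin s => p l) = lieMulti x y fun l : Fin r => p l := by
  induction s, hrs using Nat.le_induction with
  | base => rfl
  | succ s hs ih => simp [lieMulti_succ, hp s hs, ← ih]

/-- The commutator `[x, y_0^{(p_0)}, y_1^{(p_1)}, …]` for a finitely supported sequence of exponents
`p`. -/
def lieMono (x : L) (y : ℕ → L) (p : ℕ →₀ ℕ) : L :=
  lieMulti x y fun l : Fin (p.support.sup Nat.succ) => p l

theorem lieMono_eq_lieMulti (x : L) (y : ℕ → L) (p : ℕ →₀ ℕ) {r : ℕ}
    (hp : ∀ l, r ≤ l → p l = 0) : lieMono x y p = lieMulti x y fun l : Fin r => p l := by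
  refine (lieMulti_eq_of_le x y p (Finset.sup_le fun l hl => ?_) fun l hl => ?_).symm
  · by_contra h
    exact Finsupp.mem_support_iff.mp hl (hp l (by grind))
  · by_contra h
    have := Finset.le_sup (f := Nat.succ) (Finsupp.mem_support_iff.mpr h)
    grind

theorem exists_bound (p : ℕ →₀ ℕ) : ∃ r, ∀ l, r ≤ l → p l = 0 := by
  refine ⟨p.support.sup Nat.succ, fun l hl => ?_⟩
  by_contra h
  have := Finset.le_sup (f := Nat.succ) (Finsupp.mem_support_iff.mpr h)
  grind

@[simp]
theorem lieMono_zero (x : L) (y : ℕ → L) : lieMono x y 0 = x := by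
  rw [lieMono_eq_lieMulti x y 0 (r := 0) (by simp), lieMulti_zero]

theorem map_lieMono {K L' : Type*} [CommRing K] [LieAlgebra K L] [LieRing L'] [LieAlgebra K L']
    (φ : L →ₗ⁅K⁆ L') (x : L) (y : ℕ → L) (p : ℕ →₀ ℕ) :
    φ (lieMono x y p) = lieMono (φ x) (φ ∘ y) p :=
  map_lieMulti _ _ _ _

/-- The extension by zeros of a finite sequence of exponents. -/
def extendZero {r : ℕ} (p : Fin r → ℕ) : ℕ →₀ ℕ :=
  (Finsupp.equivFunOnFinite.symm p).mapDomain Fin.val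

@[simp]
theorem extendZero_val {r : ℕ} (p : Fin r → ℕ) (l : Fin r) : extendZero p l = p l :=
  Finsupp.mapDomain_apply Fin.val_injective _ _

theorem extendZero_of_le {r : ℕ} (p : Fin r → ℕ) {l : ℕ} (hl : r ≤ l) : extendZero p l = 0 :=
  Finsupp.mapDomain_of_notMem_range _ _ (by rintro ⟨k, rfl⟩; omega)

theorem lieMono_extendZero (x : L) (y : ℕ → L) {r : ℕ} (p : Fin r → ℕ) :
    lieMono x y (extendZero p) = lieMulti x y p := by
  rw [lieMono_eq_lieMulti x y _ (r := r) fun l hl => extendZero_of_le p hl]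
  simp

end Commutators

/-! ### Reduced exponents -/

/-- The finitely supported exponent sequences all of whose entries are smaller than `|K|`, with the
lexicographic order. -/
abbrev RedExp (K : Type*) : Type :=
  {p : Lex (ℕ →₀ ℕ) // ∀ l, ((ofLex p l : ℕ) : ℕ∞) < ENat.card K}

/-- The pairs `(i, p)` that number the commutators `[z_i, y_0^{(p_0)}, y_1^{(p_1)}, …]` with
exponents smaller than `|K|`, ordered by `i` first. -/
abbrev CommIndex (K : Type*) : Type := ℕ ×ₗ RedExp K

/-- The pairs `u < v` that number the brackets of two commutators. -/
abbrev PairIndex (K : Type*) : Type := {w : CommIndex K × CommIndex K // w.1 < w.2}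

/-- The commutator `[z_i, y_0^{(p_0)}, y_1^{(p_1)}, …]` with index `(i, p)`. -/
def comm {K L : Type*} [LieRing L] (y z : ℕ → L) (u : CommIndex K) : L :=
  lieMono (z (ofLex u).1) y (ofLex ((ofLex u).2 : Lex (ℕ →₀ ℕ)))

/-- The bracket of two of the commutators. -/
def pairComm {K L : Type*} [LieRing L] (y z : ℕ → L) (w : PairIndex K) : L :=
  ⁅comm y z w.1.1, comm y z w.1.2⁆

theorem map_comm {K L L' : Type*} [CommRing K] [LieRing L] [LieAlgebra K L] [LieRing L']
    [LieAlgebra K L'] (φ : L →ₗ⁅K⁆ L') (y z : ℕ → L) (u : CommIndex K) :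
    φ (comm y z u) = comm (φ ∘ y) (φ ∘ z) u :=
  map_lieMono _ _ _ _

theorem map_pairComm {K L L' : Type*} [CommRing K] [LieRing L] [LieAlgebra K L] [LieRing L']
    [LieAlgebra K L'] (φ : L →ₗ⁅K⁆ L') (y z : ℕ → L) (w : PairIndex K) :
    φ (pairComm y z w) = pairComm (φ ∘ y) (φ ∘ z) w := by
  simp only [pairComm, LieHom.map_lie, map_comm]

section

variable (K : Type*) [Field K]

theorem zero_lt_enatCard : (0 : ℕ∞) < ENat.card K :=
  zero_lt_one.trans ENat.one_lt_card

theorem extendZero_lt {r : ℕ} {p : Fin r → ℕ} (hp : ∀ l, (p l : ℕ∞) < ENat.card K) (l : ℕ) :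
    ((extendZero p l : ℕ) : ℕ∞) < ENat.card K := by
  rcases lt_or_ge l r with hl | hl
  · simpa using (extendZero_val p ⟨l, hl⟩) ▸ hp ⟨l, hl⟩
  · rw [extendZero_of_le p hl]
    exact zero_lt_enatCard K

/-- The reduced commutators are exactly the polynomials in `linearPolys`: exponent sequences that
differ by trailing zeros define the same commutator and have the same index. -/
theorem range_comm : Set.range (comm (K := K) (yVar K) (zVar K)) = linearPolys K := by
  ext f
  constructor
  · rintro ⟨u, rfl⟩
    obtain ⟨i, p, hp⟩ := u
    obtain ⟨r, hr⟩ := exists_bound (ofLex p)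
    exact ⟨i, r, _, fun l => hp l, lieMono_eq_lieMulti _ _ _ hr⟩
  · rintro ⟨i, r, p, hp, rfl⟩
    exact ⟨toLex (i, ⟨toLex (extendZero p), extendZero_lt K hp⟩), lieMono_extendZero _ _ _⟩

theorem toLex_extendZero_lt {r : ℕ} {p q : Fin r → ℕ} :
    toLex (extendZero p) < toLex (extendZero q) ↔ toLex p < toLex q := by
  rw [Finsupp.Lex.lt_iff]
  constructor
  · rintro ⟨l, h1, h2⟩
    rcases lt_or_ge l r with hl | hl
    · refine ⟨⟨l, hl⟩, fun j hj => ?_, ?_⟩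
      · simpa using h1 j hj
      · simpa using (extendZero_val p ⟨l, hl⟩) ▸ (extendZero_val q ⟨l, hl⟩) ▸ h2
    · change extendZero p l < extendZero q l at h2
      rw [extendZero_of_le q hl] at h2
      omega
  · rintro ⟨l, h1, h2⟩
    refine ⟨l, fun j hj => ?_, ?_⟩
    · have := h1 ⟨j, hj.trans l.2⟩ hj
      change extendZero p j = extendZero q j
      simpa using (extendZero_val p ⟨j, hj.trans l.2⟩).trans
        (this.trans (extendZero_val q ⟨j, hj.trans l.2⟩).symm)
    · change extendZero p l < extendZero q l
      simpa using h2

theorem range_pairComm :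
    Set.range (pairComm (K := K) (yVar K) (zVar K)) = quadraticPolys K := by
  ext f
  constructor
  · rintro ⟨⟨⟨u, v⟩, huv⟩, rfl⟩
    obtain ⟨i, p, hp⟩ := u
    obtain ⟨j, q, hq⟩ := v
    obtain ⟨r, hr⟩ := exists_bound (ofLex p)
    obtain ⟨s, hs⟩ := exists_bound (ofLex q)
    -- Both exponent sequences are padded with zeros to a common length.
    have hr' : ∀ l, max r s ≤ l → ofLex p l = 0 := fun l hl => hr l (by omega)
    have hs' : ∀ l, max r s ≤ l → ofLex q l = 0 := fun l hl => hs l (by omega)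
    have hext : ∀ p : ℕ →₀ ℕ, (∀ l, max r s ≤ l → p l = 0) →
        extendZero (fun l : Fin (max r s) => p l) = p := by
      intro p hp
      ext l
      rcases lt_or_ge l (max r s) with hl | hl
      · exact extendZero_val _ ⟨l, hl⟩
      · rw [extendZero_of_le _ hl, hp l hl]
    refine ⟨i, j, max r s, fun l => ofLex p l, fun l => ofLex q l, ?_, fun l => hp l,
      fun l => hq l, fun hij => ?_, ?_⟩
    · rcases Prod.Lex.lt_iff.mp huv with h | h
      · exact h.le
      · exact h.1.le
    · rw [← toLex_extendZero_lt, hext _ hr', hext _ hs']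
      rcases Prod.Lex.lt_iff.mp huv with h | h
      · exact absurd hij h.ne
      · exact h.2
    · rw [← lieMono_eq_lieMulti _ _ _ hr', ← lieMono_eq_lieMulti _ _ _ hs']
      rfl
  · rintro ⟨i, j, r, p, q, hij, hp, hq, hpq, rfl⟩
    refine ⟨⟨(toLex (i, ⟨toLex (extendZero p), extendZero_lt K hp⟩),
      toLex (j, ⟨toLex (extendZero q), extendZero_lt K hq⟩)), ?_⟩, ?_⟩
    · rw [Prod.Lex.lt_iff]
      rcases hij.lt_or_eq with h | h
      · exact Or.inl h
      · exact Or.inr ⟨h, toLex_extendZero_lt.mpr (hpq h)⟩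
    · exact congrArg₂ _ (lieMono_extendZero _ _ _) (lieMono_extendZero _ _ _)

end

/-! ### Spanning -/

theorem lift_mem {K X L : Type*} [CommRing K] [LieRing L] [LieAlgebra K L] (N : LieSubalgebra K L)
    {f : X → L} (hf : ∀ x, f x ∈ N) (a : FreeLieAlgebra K X) : FreeLieAlgebra.lift K f a ∈ N := by
  have h : FreeLieAlgebra.lift K f =
      N.incl.comp (FreeLieAlgebra.lift K fun x => (⟨f x, hf x⟩ : N)) := by
    ext x
    simp
  rw [h]
  exact (FreeLieAlgebra.lift K (fun x => (⟨f x, hf x⟩ : N)) a).2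

/-- The elements of a Lie algebra that map a subspace into itself. -/
def stabilizer {K L : Type*} [CommRing K] [LieRing L] [LieAlgebra K L] (U : Submodule K L) :
    LieSubalgebra K L where
  carrier := {x | ∀ u ∈ U, ⁅x, u⁆ ∈ U}
  add_mem' ha hb u hu := by
    rw [add_lie]
    exact U.add_mem (ha u hu) (hb u hu)
  zero_mem' u _ := by simp
  smul_mem' c a ha u hu := by
    rw [smul_lie]
    exact U.smul_mem c (ha u hu)
  lie_mem' {a b} ha hb u hu := by
    rw [lie_lie]
    exact U.sub_mem (ha _ (hb u hu)) (hb _ (ha u hu))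

/-- The relations satisfied, in a Lie algebra over `K`, by elements `y i` and `z i` and a set `V`
that contains the `z i` and plays the role of the elements of degree one. -/
structure OddRelations (K : Type*) [Field K] {A : Type*} [LieRing A] (y z : ℕ → A)
    (V : Set A) : Prop where
  mem (i : ℕ) : z i ∈ V
  lie_mem {u : A} (hu : u ∈ V) (l : ℕ) : ⁅u, y l⁆ ∈ V
  nilpotent {u v w : A} (hu : u ∈ V) (hv : v ∈ V) (hw : w ∈ V) : ⁅⁅u, v⁆, w⁆ = 0
  lie_comm {u : A} (hu : u ∈ V) (k l : ℕ) : ⁅⁅u, y k⁆, y l⁆ = ⁅⁅u, y l⁆, y k⁆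
  frobenius [Finite K] {u : A} (hu : u ∈ V) (l : ℕ) :
    lieRepeat u (y l) (Nat.card K) = ⁅u, y l⁆

theorem comm_lie_comm_mem {K : Type*} [Field K] {A : Type*} [LieRing A] [LieAlgebra K A]
    (y z : ℕ → A) (u v : CommIndex K) :
    ⁅comm y z u, comm y z v⁆ ∈ Submodule.span K (Set.range (pairComm (K := K) y z)) := by
  rcases lt_trichotomy u v with huv | rfl | huv
  · exact Submodule.subset_span ⟨⟨(u, v), huv⟩, rfl⟩
  · simp
  · rw [← lie_skew]
    exact Submodule.neg_mem _ (Submodule.subset_span ⟨⟨(v, u), huv⟩, rfl⟩)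

namespace OddRelations

variable {K : Type*} [Field K] {A : Type*} [LieRing A] {y z : ℕ → A} {V : Set A}
  (h : OddRelations K y z V)
include h

theorem lieRepeat_mem {u : A} (hu : u ∈ V) (l m : ℕ) : lieRepeat u (y l) m ∈ V := by
  induction m with
  | zero => exact hu
  | succ m ih => rw [lieRepeat_succ]; exact h.lie_mem ih l

theorem lieMulti_mem {u : A} (hu : u ∈ V) {r : ℕ} (p : Fin r → ℕ) : lieMulti u y p ∈ V := by
  induction r with
  | zero => simpa
  | succ r ih => rw [lieMulti_succ]; exact h.lieRepeat_mem (ih _) _ _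

theorem comm_mem (u : CommIndex K) : comm y z u ∈ V :=
  h.lieMulti_mem (h.mem _) fun l : Fin _ => (ofLex ((ofLex u).2 : Lex (ℕ →₀ ℕ))) l

theorem lieRepeat_lie {u : A} (hu : u ∈ V) (k l m : ℕ) :
    ⁅lieRepeat u (y k) m, y l⁆ = lieRepeat ⁅u, y l⁆ (y k) m := by
  induction m with
  | zero => rfl
  | succ m ih =>
    rw [lieRepeat_succ, lieRepeat_succ, h.lie_comm (h.lieRepeat_mem hu _ _), ih]

theorem lieMulti_lie {u : A} (hu : u ∈ V) (p : ℕ → ℕ) {l r : ℕ} (hl : l < r) :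
    ⁅lieMulti u y fun k : Fin r => p k, y l⁆ =
      lieMulti u y fun k : Fin r => (p + Pi.single l 1 : ℕ → ℕ) k := by
  induction r with
  | zero => omega
  | succ r ih =>
    rw [lieMulti_succ, lieMulti_succ]
    simp only [Fin.val_castSucc, Fin.val_last]
    rcases Nat.lt_succ_iff_lt_or_eq.mp hl with hlr | rfl
    · rw [h.lieRepeat_lie (h.lieMulti_mem hu _), ih hlr]
      simp [hlr.ne']
    · have : (fun k : Fin l => (p + Pi.single l 1 : ℕ → ℕ) k) = fun k : Fin l => p k := by
        funext k
        simp [k.2.ne]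
      rw [this]
      simp [lieRepeat_succ]

theorem lieMono_lie {u : A} (hu : u ∈ V) (p : ℕ →₀ ℕ) (l : ℕ) :
    ⁅lieMono u y p, y l⁆ = lieMono u y (p + Finsupp.single l 1) := by
  obtain ⟨r, hr⟩ := exists_bound (p + Finsupp.single l 1)
  have hl : l < r := by
    by_contra hl
    simpa using hr l (by omega)
  rw [lieMono_eq_lieMulti _ _ p (r := r) fun k hk => by have := hr k hk; simp at this; exact this.1,
    lieMono_eq_lieMulti _ _ _ hr, h.lieMulti_lie hu _ hl]
  simp [Finsupp.single_eq_pi_single]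

/-- An exponent may be replaced by one smaller than `|K|`: over a field with `q` elements, an
exponent `m ≥ q` may be lowered by `q - 1`. The zero exponent is kept, so that the replacement
preserves finite support. -/
theorem exists_lieRepeat_eq (m : ℕ) : ∃ n : ℕ, (n : ℕ∞) < ENat.card K ∧ (m = 0 → n = 0) ∧
    ∀ u ∈ V, ∀ l, lieRepeat u (y l) m = lieRepeat u (y l) n := by
  induction m using Nat.strong_induction_on with
  | _ m ih =>
    by_cases hm : (m : ℕ∞) < ENat.card K
    · exact ⟨m, hm, id, fun _ _ _ => rfl⟩
    · have hK : Finite K := by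
        rw [← ENat.card_lt_top]
        exact (not_lt.mp hm).trans_lt (ENat.natCast_lt_top m)
      rw [ENat.card_eq_coe_natCard, Nat.cast_lt, not_lt] at hm
      have hq : 1 < Nat.card K := Finite.one_lt_card
      obtain ⟨n, h1, -, h2⟩ := ih (m - Nat.card K + 1) (by omega)
      refine ⟨n, h1, by omega, fun u hu l => ?_⟩
      rw [← h2 u hu l]
      conv_lhs => rw [← Nat.sub_add_cancel hm, lieRepeat_add, h.frobenius hu]
      rw [lieRepeat_add]
      rfl

theorem exists_lieMono_eq (p : ℕ →₀ ℕ) : ∃ q : ℕ →₀ ℕ, (∀ l, (q l : ℕ∞) < ENat.card K) ∧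
    ∀ u ∈ V, lieMono u y p = lieMono u y q := by
  choose red h1 h2 h3 using h.exists_lieRepeat_eq
  refine ⟨p.mapRange red (h2 0 rfl), fun l => by simpa using h1 _, fun u hu => ?_⟩
  obtain ⟨r, hr⟩ := exists_bound p
  rw [lieMono_eq_lieMulti _ _ _ hr, lieMono_eq_lieMulti _ _ _ (r := r) fun l hl => by
    simp [hr l hl, h2 0 rfl]]
  simp only [Finsupp.mapRange_apply]
  clear hr
  induction r with
  | zero => simp
  | succ r ih =>
    rw [lieMulti_succ, lieMulti_succ]
    simp only [Fin.val_castSucc, Fin.val_last]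
    rw [ih, h3 _ _ (h.lieMulti_mem hu _)]

theorem lieMono_mem_range (i : ℕ) (p : ℕ →₀ ℕ) :
    lieMono (z i) y p ∈ Set.range (comm (K := K) y z) := by
  obtain ⟨q, hq, hpq⟩ := h.exists_lieMono_eq p
  exact ⟨toLex (i, ⟨toLex q, hq⟩), (hpq _ (h.mem i)).symm⟩

theorem comm_lie_mem_range (u : CommIndex K) (l : ℕ) :
    ⁅comm y z u, y l⁆ ∈ Set.range (comm (K := K) y z) := by
  rw [comm, h.lieMono_lie (h.mem _)]
  exact h.lieMono_mem_range _ _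

variable [LieAlgebra K A]

/-- If the `y i` and `z i` generate the Lie algebra, it is spanned by the polynomials in the `y i`,
the reduced commutators and the brackets of two of these. The sum of the three subspaces contains
the generators and is stable under bracketing with them, hence it is an ideal that contains the
generators. -/
theorem span_eq_top (hgen : ∀ N : LieSubalgebra K A, (∀ i, y i ∈ N) → (∀ i, z i ∈ N) → N = ⊤) :
    (FreeLieAlgebra.lift K y).range.toSubmodule ⊔
      (Submodule.span K (Set.range (comm (K := K) y z)) ⊔
        Submodule.span K (Set.range (pairComm (K := K) y z))) = ⊤ := by
  set Y := (FreeLieAlgebra.lift K y).range.toSubmodule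
  set U := Submodule.span K (Set.range (comm (K := K) y z))
  set P := Submodule.span K (Set.range (pairComm (K := K) y z))
  have hyY (l : ℕ) : y l ∈ Y := ⟨FreeLieAlgebra.of K l, by simp⟩
  have hzU (i : ℕ) : z i ∈ U := by
    rw [← lieMono_zero (z i) y]
    exact Submodule.subset_span (h.lieMono_mem_range i 0)
  have hyU (l : ℕ) : ∀ u ∈ U, ⁅y l, u⁆ ∈ U := by
    intro u hu
    induction hu using Submodule.span_induction with
    | mem u hu =>
      obtain ⟨u, rfl⟩ := hu
      rw [← lie_skew]
      exact U.neg_mem (Submodule.subset_span (h.comm_lie_mem_range u l))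
    | zero => simp
    | add u v _ _ hu hv => rw [lie_add]; exact U.add_mem hu hv
    | smul c u _ hu => rw [lie_smul]; exact U.smul_mem c hu
  have hYU (f : A) (hf : f ∈ Y) : ∀ u ∈ U, ⁅f, u⁆ ∈ U := by
    obtain ⟨g, rfl⟩ := hf
    exact lift_mem (stabilizer U) hyU g
  have hUU : ∀ u ∈ U, ∀ v ∈ U, ⁅u, v⁆ ∈ P := by
    intro u hu v hv
    induction hu, hv using Submodule.span_induction₂ with
    | mem_mem u v hu hv =>
      obtain ⟨u, rfl⟩ := hu
      obtain ⟨v, rfl⟩ := hv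
      exact comm_lie_comm_mem y z u v
    | zero_left => simp
    | zero_right => simp
    | add_left u v w _ _ _ h1 h2 => rw [add_lie]; exact P.add_mem h1 h2
    | add_right u v w _ _ _ h1 h2 => rw [lie_add]; exact P.add_mem h1 h2
    | smul_left c u v _ _ h1 => rw [smul_lie]; exact P.smul_mem c h1
    | smul_right c u v _ _ h1 => rw [lie_smul]; exact P.smul_mem c h1
  have hyP (l : ℕ) : ∀ w ∈ P, ⁅y l, w⁆ ∈ P := by
    intro w hw
    induction hw using Submodule.span_induction with
    | mem w hw =>
      obtain ⟨⟨⟨u, v⟩, huv⟩, rfl⟩ := hw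
      have hu : comm y z u ∈ U := Submodule.subset_span ⟨u, rfl⟩
      have hv : comm y z v ∈ U := Submodule.subset_span ⟨v, rfl⟩
      rw [pairComm, leibniz_lie]
      exact P.add_mem (hUU _ (hyU l _ hu) _ hv) (hUU _ hu _ (hyU l _ hv))
    | zero => simp
    | add u v _ _ hu hv => rw [lie_add]; exact P.add_mem hu hv
    | smul c u _ hu => rw [lie_smul]; exact P.smul_mem c hu
  have hzP (i : ℕ) : ∀ w ∈ P, ⁅z i, w⁆ = 0 := by
    intro w hw
    induction hw using Submodule.span_induction with
    | mem w hw =>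
      obtain ⟨⟨⟨u, v⟩, huv⟩, rfl⟩ := hw
      rw [← lie_skew, pairComm, h.nilpotent (h.comm_mem u) (h.comm_mem v) (h.mem i), neg_zero]
    | zero => simp
    | add u v _ _ hu hv => rw [lie_add, hu, hv, add_zero]
    | smul c u _ hu => rw [lie_smul, hu, smul_zero]
  have hstab : stabilizer (Y ⊔ (U ⊔ P)) = ⊤ := by
    refine hgen _ (fun l w hw => ?_) fun i w hw => ?_
    all_goals
      obtain ⟨f, hf, v, hv, rfl⟩ := Submodule.mem_sup.mp hw
      obtain ⟨u, hu, w, hwP, rfl⟩ := Submodule.mem_sup.mp hv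
      rw [lie_add, lie_add]
    · exact Submodule.add_mem_sup ((FreeLieAlgebra.lift K y).range.lie_mem (hyY l) hf)
        (Submodule.add_mem_sup (hyU l u hu) (hyP l w hwP))
    · rw [hzP i w hwP, add_zero, ← lie_skew]
      exact Submodule.mem_sup_right (Submodule.add_mem_sup (U.neg_mem (hYU f hf _ (hzU i)))
        (hUU _ (hzU i) u hu))
  let N : LieSubalgebra K A :=
    { (Y ⊔ (U ⊔ P)) with
      lie_mem' := fun {a b} _ hb => by
        have ha : a ∈ stabilizer (Y ⊔ (U ⊔ P)) := hstab ▸ LieSubalgebra.mem_top a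
        exact ha b hb }
  have hN : N = ⊤ := hgen N (fun l => Submodule.mem_sup_left (hyY l))
    fun i => Submodule.mem_sup_right (Submodule.mem_sup_left (hzU i))
  exact congrArg LieSubalgebra.toSubmodule hN

end OddRelations

/-! ### Linear independence of reduced monomial functions -/

/-- A polynomial, in any number of variables, whose degree in each of them is smaller than `|K|`
vanishes as soon as the function that it defines does. -/
theorem eq_zero_of_eval_eq_zero_of_degreeOf_lt {K σ : Type*} [Field K] (P : MvPolynomial σ K)
    (hdeg : ∀ i, (P.degreeOf i : ℕ∞) < ENat.card K) (heval : ∀ x, MvPolynomial.eval x P = 0) :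
    P = 0 := by
  obtain ⟨s, Q, rfl⟩ := MvPolynomial.exists_finset_rename P
  have hS (i : s) : ∃ S : Finset K, Q.degreeOf i < S.card := by
    have h := hdeg i
    rw [MvPolynomial.degreeOf_rename_of_injective Subtype.val_injective] at h
    rcases finite_or_infinite K with hK | hK
    · have := Fintype.ofFinite K
      refine ⟨Finset.univ, ?_⟩
      rwa [ENat.card_eq_coe_fintype_card, Nat.cast_lt] at h
    · obtain ⟨S, hS⟩ := Infinite.exists_subset_card_eq K (Q.degreeOf i + 1)
      exact ⟨S, by omega⟩
  choose S hS using hS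
  rw [MvPolynomial.eq_zero_of_eval_zero_at_prod_finset Q S hS fun x _ => ?_, map_zero]
  have h := heval (Function.extend Subtype.val x 0)
  rwa [MvPolynomial.eval_rename, Function.extend_comp Subtype.val_injective] at h

theorem linearIndependent_monomial_functions (K : Type*) [Field K] :
    LinearIndependent K fun (p : RedExp K) (a : ℕ → K) =>
      (ofLex (p : Lex (ℕ →₀ ℕ))).prod fun l m => a l ^ m := by
  classical
  rw [linearIndependent_iff']
  intro s g hg p hp
  have hP : ∑ q ∈ s, MvPolynomial.monomial (ofLex (q : Lex (ℕ →₀ ℕ))) (g q) = 0 := by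
    refine eq_zero_of_eval_eq_zero_of_degreeOf_lt _ (fun i => ?_) fun a => ?_
    · refine lt_of_le_of_lt (Nat.cast_le.mpr (MvPolynomial.degreeOf_sum_le i s _)) ?_
      rcases s.eq_empty_or_nonempty with rfl | hs
      · simp at hp
      · obtain ⟨q, hq, h⟩ := Finset.exists_mem_eq_sup s hs fun q =>
          MvPolynomial.degreeOf i (MvPolynomial.monomial (ofLex (q : Lex (ℕ →₀ ℕ))) (g q))
        rw [h]
        refine lt_of_le_of_lt (Nat.cast_le.mpr ?_) (q.2 i)
        rw [MvPolynomial.degreeOf_eq_sup]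
        refine Finset.sup_le fun m hm => ?_
        rw [Finset.mem_singleton.mp (MvPolynomial.support_monomial_subset hm)]
    · have := congrFun hg a
      simpa [MvPolynomial.eval_monomial, Finset.sum_apply] using this
  have := congrArg (MvPolynomial.coeff (ofLex (p : Lex (ℕ →₀ ℕ)))) hP
  rw [MvPolynomial.coeff_sum, Finset.sum_eq_single p, MvPolynomial.coeff_monomial,
    if_pos rfl] at this
  · simpa using this
  · intro q _ hq
    rw [MvPolynomial.coeff_monomial, if_neg]
    exact fun h => hq (Subtype.ext (ofLex.injective h))
  · exact fun h => absurd hp h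

/-- Products of two linearly independent families of functions in separate variables are linearly
independent. -/
theorem linearIndependent_mul_functions {K X X' ι κ : Type*} [Field K] {f : ι → X → K}
    {g : κ → X' → K} (hf : LinearIndependent K f) (hg : LinearIndependent K g) :
    LinearIndependent K fun (w : ι × κ) (x : X × X') => f w.1 x.1 * g w.2 x.2 := by
  classical
  rw [linearIndependent_iff'] at hf hg ⊢
  intro s c hc w hw
  -- Extended by zero, the sum over `s` becomes a sum over a product of two finite sets.
  let c' : ι × κ → K := fun w => if w ∈ s then c w else 0
  have hc' : ∀ x x', ∑ a ∈ s.image Prod.fst, ∑ b ∈ s.image Prod.snd,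
      c' (a, b) * (f a x * g b x') = 0 := by
    intro x x'
    rw [← Finset.sum_product']
    have := congrFun hc (x, x')
    simp only [Finset.sum_apply, Pi.smul_apply, smul_eq_mul, Pi.zero_apply] at this
    rw [← this]
    symm
    refine Finset.sum_subset_zero_on_sdiff Finset.subset_product (fun v hv => ?_) fun v hv => ?_
    · simp [c', (Finset.mem_sdiff.mp hv).2]
    · simp [c', hv]
  have h1 : ∀ a ∈ s.image Prod.fst, ∀ x', ∑ b ∈ s.image Prod.snd, c' (a, b) * g b x' = 0 := by
    intro a ha x'
    refine hf (s.image Prod.fst) (fun a => ∑ b ∈ s.image Prod.snd, c' (a, b) * g b x') ?_ a ha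
    funext x
    simp only [Finset.sum_apply, Pi.smul_apply, smul_eq_mul, Pi.zero_apply]
    rw [← hc' x x']
    refine Finset.sum_congr rfl fun a _ => ?_
    rw [Finset.sum_mul]
    exact Finset.sum_congr rfl fun b _ => by ring
  have h2 := hg (s.image Prod.snd) (fun b => c' (w.1, b)) (by
    funext x'
    simpa [Finset.sum_apply] using h1 w.1 (Finset.mem_image_of_mem _ hw) x') w.2
    (Finset.mem_image_of_mem _ hw)
  simpa [c', hw] using h2

/-- Differences of members of a linearly independent family are linearly independent if the minuends
are distinct and no subtrahend occurs among them. -/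
theorem linearIndependent_sub {K M ι κ : Type*} [Ring K] [AddCommGroup M] [Module K M]
    {e : ι → M} (he : LinearIndependent K e) {a b : κ → ι} (ha : Function.Injective a)
    (hab : ∀ k l, a k ≠ b l) : LinearIndependent K fun k => e (a k) - e (b k) := by
  classical
  -- Restricting the coordinates to the range of `a` turns the differences into a standard basis.
  have h : LinearIndependent K fun k : κ =>
      (Finsupp.single (a k) 1 - Finsupp.single (b k) 1 : ι →₀ K) := by
    refine LinearIndependent.of_comp (Finsupp.lcomapDomain a ha) ?_
    convert Finsupp.linearIndependent_single_one K κ with k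
    ext l
    have : b k ≠ a l := (hab l k).symm
    simp [Finsupp.single_apply, ha.eq_iff, this]
  convert h.map' (Finsupp.linearCombination K e) (LinearMap.ker_eq_bot.mpr he) with k
  simp

/-- The value at a point `(x, a)` of the function `x_i · a_0^{p_0} a_1^{p_1} ⋯`, which is
the coefficient of `e_{12}` in the commutator with index `(i, p)` under the substitutions
`pointSubst`. -/
def commValue {K : Type*} [Field K] (u : CommIndex K) (c : (ℕ → K) × (ℕ → K)) : K :=
  c.1 (ofLex u).1 * (ofLex ((ofLex u).2 : Lex (ℕ →₀ ℕ))).prod fun l m => c.2 l ^ m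

theorem linearIndependent_commValue (K : Type*) [Field K] :
    LinearIndependent K (commValue (K := K)) := by
  have hx : LinearIndependent K fun (i : ℕ) (x : ℕ → K) => x i := by
    rw [linearIndependent_iff']
    intro s g hg i hi
    simpa [Finset.sum_apply, Pi.single_apply, hi] using congrFun hg (Pi.single i 1)
  exact (linearIndependent_mul_functions hx (linearIndependent_monomial_functions K)).comp
    (fun u : CommIndex K => ofLex u) ofLex.injective

/-- The alternating products of the functions `commValue`. -/
def pairValue {K : Type*} [Field K] (w : PairIndex K)
    (c : ((ℕ → K) × (ℕ → K)) × ((ℕ → K) × (ℕ → K))) : K :=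
  commValue w.1.1 c.1 * commValue w.1.2 c.2 - commValue w.1.2 c.1 * commValue w.1.1 c.2

theorem linearIndependent_pairValue (K : Type*) [Field K] :
    LinearIndependent K (pairValue (K := K)) := by
  have hmul : LinearIndependent K fun (w : CommIndex K × CommIndex K)
      (c : ((ℕ → K) × (ℕ → K)) × ((ℕ → K) × (ℕ → K))) =>
        commValue w.1 c.1 * commValue w.2 c.2 :=
    linearIndependent_mul_functions (linearIndependent_commValue K) (linearIndependent_commValue K)
  have hne (w w' : PairIndex K) : w.1 ≠ w'.1.swap := fun h => by
    have hw : w'.1.2 < w'.1.1 := by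
      have := w.2
      rwa [h] at this
    exact lt_asymm hw w'.2
  have hsub := linearIndependent_sub hmul (a := fun w : PairIndex K => w.1)
    (b := fun w : PairIndex K => w.1.swap) Subtype.val_injective hne
  exact hsub

/-! ### `T`-ideals and graded identities -/

theorem mem_gradedIdentities {K G L : Type*} [CommRing K] [LieRing L] [LieAlgebra K L]
    {Γ : G → Submodule K L} {f : FreeGraded K G} :
    f ∈ gradedIdentities Γ ↔
      ∀ σ : ℕ × G → L, (∀ i g, σ (i, g) ∈ Γ g) → FreeLieAlgebra.lift K σ f = 0 := by
  simp [gradedIdentities, LieSubmodule.mem_iInf]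

section TIdeals

variable {K G : Type*} [CommRing K] [AddCommGroup G]

theorem mem_tIdealSpan {S : Set (FreeGraded K G)} {f : FreeGraded K G} :
    f ∈ tIdealSpan S ↔ ∀ I : LieIdeal K (FreeGraded K G), IsTIdeal I ∧ S ⊆ I → f ∈ I := by
  rw [tIdealSpan, ← SetLike.mem_coe, LieSubmodule.coe_sInf]
  simp only [Set.mem_iInter, SetLike.mem_coe, Set.mem_ofPred_eq]

theorem isTIdeal_tIdealSpan (S : Set (FreeGraded K G)) : IsTIdeal (tIdealSpan S) := by
  intro φ hφ f hf
  rw [mem_tIdealSpan] at hf ⊢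
  exact fun I hI => hI.1 φ hφ f (hf I hI)

theorem subset_tIdealSpan (S : Set (FreeGraded K G)) : S ⊆ tIdealSpan S := by
  intro f hf
  rw [SetLike.mem_coe, mem_tIdealSpan]
  exact fun I hI => hI.2 hf

theorem tIdealSpan_le {S : Set (FreeGraded K G)} {I : LieIdeal K (FreeGraded K G)}
    (hI : IsTIdeal I) (hS : S ⊆ I) : tIdealSpan S ≤ I :=
  sInf_le ⟨hI, hS⟩

theorem of_mem_freeComponent (i : ℕ) (g : G) : FreeLieAlgebra.of K (i, g) ∈ freeComponent K g :=
  Submodule.subset_span (IsMonomial.of i g)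

theorem lie_mem_freeComponent {a b : FreeGraded K G} {g h : G} (ha : a ∈ freeComponent K g)
    (hb : b ∈ freeComponent K h) : ⁅a, b⁆ ∈ freeComponent K (g + h) := by
  induction ha, hb using Submodule.span_induction₂ with
  | mem_mem u v hu hv => exact Submodule.subset_span (IsMonomial.lie hu hv)
  | zero_left => simp
  | zero_right => simp
  | add_left u v w _ _ _ h1 h2 => rw [add_lie]; exact Submodule.add_mem _ h1 h2
  | add_right u v w _ _ _ h1 h2 => rw [lie_add]; exact Submodule.add_mem _ h1 h2
  | smul_left c u v _ _ h1 => rw [smul_lie]; exact Submodule.smul_mem _ c h1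
  | smul_right c u v _ _ h1 => rw [lie_smul]; exact Submodule.smul_mem _ c h1

variable {L : Type*} [LieRing L] [LieAlgebra K L]

theorem mem_identities {f : FreeLieAlgebra K ℕ} :
    f ∈ identities K L ↔ ∀ σ : ℕ → L, FreeLieAlgebra.lift K σ f = 0 := by
  simp [identities, LieSubmodule.mem_iInf]

variable {Γ : G → Submodule K L}
  (hΓ : ∀ {a b : L} {g h : G}, a ∈ Γ g → b ∈ Γ h → ⁅a, b⁆ ∈ Γ (g + h))
include hΓ

theorem lift_mem_of_mem_freeComponent {σ : ℕ × G → L} (hσ : ∀ i g, σ (i, g) ∈ Γ g) {d : G}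
    {f : FreeGraded K G} (hf : f ∈ freeComponent K d) : FreeLieAlgebra.lift K σ f ∈ Γ d := by
  suffices h : freeComponent K d ≤ (Γ d).comap (FreeLieAlgebra.lift K σ : _ →ₗ[K] L) from h hf
  refine Submodule.span_le.mpr fun m hm => ?_
  change FreeLieAlgebra.lift K σ m ∈ Γ d
  clear hf
  induction hm with
  | of i g => simpa using hσ i g
  | lie _ _ h1 h2 =>
    rw [LieHom.map_lie]
    exact hΓ h1 h2

theorem isTIdeal_gradedIdentities : IsTIdeal (gradedIdentities Γ) := by
  intro φ hφ f hf
  rw [mem_gradedIdentities] at hf ⊢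
  intro σ hσ
  have h : (FreeLieAlgebra.lift K σ).comp φ =
      FreeLieAlgebra.lift K fun x => FreeLieAlgebra.lift K σ (φ (FreeLieAlgebra.of K x)) := by
    ext x
    simp
  rw [← LieHom.comp_apply, h]
  exact hf _ fun i g => lift_mem_of_mem_freeComponent hΓ hσ (hφ i g)

end TIdeals

/-! ### The almost canonical grading -/

section Matrices

variable {K : Type*} [CommRing K]

theorem elementaryGrading_lie_mem {G : Type*} [AddCommGroup G] (g h : G) {d e : G} {M N : UT K 3}
    (hM : M ∈ elementaryGrading K g h d) (hN : N ∈ elementaryGrading K g h e) :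
    ⁅M, N⁆ ∈ elementaryGrading K g h (d + e) := by
  intro i j hij
  have hmul : ∀ (A B : UT K 3) (a b : G), A ∈ elementaryGrading K g h a →
      B ∈ elementaryGrading K g h b →
      ((A : Matrix (Fin 3) (Fin 3) K) * (B : Matrix (Fin 3) (Fin 3) K)) i j ≠ 0 →
      unitDegree g h i j = a + b := by
    intro A B a b hA hB hAB
    rw [Matrix.mul_apply] at hAB
    obtain ⟨k, -, hk⟩ := Finset.exists_ne_zero_of_sum_ne_zero hAB
    rw [← hA i k (left_ne_zero_of_mul hk), ← hB k j (right_ne_zero_of_mul hk)]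
    simp only [unitDegree]
    abel
  rw [LieSubalgebra.coe_bracket, Ring.lie_def, Matrix.sub_apply] at hij
  by_cases h0 : ((M : Matrix (Fin 3) (Fin 3) K) * (N : Matrix (Fin 3) (Fin 3) K)) i j = 0
  · rw [h0, zero_sub, neg_ne_zero] at hij
    rw [hmul N M e d hN hM hij, add_comm]
  · exact hmul M N d e hM hN h0

/-- The entry in row `i` and column `j`, as a linear form on `UT_n^{(-)}`. -/
def entry {n : ℕ} (i j : Fin n) : UT K n →ₗ[K] K :=
  Matrix.entryLinearMap K K i j ∘ₗ (UT K n).toSubmodule.subtype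

theorem entry_of_lt {n : ℕ} (M : UT K n) {i j : Fin n} (h : j < i) : entry i j M = 0 :=
  M.2 h

theorem entry_lie {n : ℕ} (M N : UT K n) (i j : Fin n) :
    entry i j ⁅M, N⁆ = ∑ k, entry i k M * entry k j N - ∑ k, entry i k N * entry k j M := by
  change (⁅M, N⁆ : UT K n).1 i j = _
  rw [LieSubalgebra.coe_bracket, Ring.lie_def, Matrix.sub_apply, Matrix.mul_apply, Matrix.mul_apply]
  rfl

theorem UT.ext_entry {n : ℕ} {M N : UT K n} (h : ∀ i j, i ≤ j → entry i j M = entry i j N) :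
    M = N := by
  refine Subtype.ext (Matrix.ext fun i j => ?_)
  rcases le_or_gt i j with hij | hij
  · exact h i j hij
  · exact (entry_of_lt M hij).trans (entry_of_lt N hij).symm

theorem UT.ext_three {M N : UT K 3} (h00 : entry 0 0 M = entry 0 0 N)
    (h01 : entry 0 1 M = entry 0 1 N) (h02 : entry 0 2 M = entry 0 2 N)
    (h11 : entry 1 1 M = entry 1 1 N) (h12 : entry 1 2 M = entry 1 2 N)
    (h22 : entry 2 2 M = entry 2 2 N) : M = N := by
  refine UT.ext_entry fun i j hij => ?_
  fin_cases i <;> fin_cases j <;> first | assumption | exact absurd hij (by decide)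

theorem UT.ext_two {M N : UT K 2} (h00 : entry 0 0 M = entry 0 0 N)
    (h01 : entry 0 1 M = entry 0 1 N) (h11 : entry 1 1 M = entry 1 1 N) : M = N := by
  refine UT.ext_entry fun i j hij => ?_
  fin_cases i <;> fin_cases j <;> first | assumption | exact absurd hij (by decide)

@[simp] theorem entry_three_one_zero (M : UT K 3) : entry 1 0 M = 0 := entry_of_lt M (by decide)
@[simp] theorem entry_three_two_zero (M : UT K 3) : entry 2 0 M = 0 := entry_of_lt M (by decide)
@[simp] theorem entry_three_two_one (M : UT K 3) : entry 2 1 M = 0 := entry_of_lt M (by decide)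
@[simp] theorem entry_two_one_zero (M : UT K 2) : entry 1 0 M = 0 := entry_of_lt M (by decide)

/-- The upper triangular `3 × 3` matrix with the given entries on and above the diagonal, read row
by row. -/
def utThree (a b c d e f : K) : UT K 3 :=
  ⟨!![a, b, c; 0, d, e; 0, 0, f], fun i j hij => by
    fin_cases i <;> fin_cases j <;> first | rfl | exact absurd hij (by decide)⟩

/-- The upper triangular `2 × 2` matrix with the given entries on and above the diagonal, read row
by row. -/
def utTwo (a b c : K) : UT K 2 :=
  ⟨!![a, b; 0, c], fun i j hij => by
    fin_cases i <;> fin_cases j <;> first | rfl | exact absurd hij (by decide)⟩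

section

variable (a b c d e f : K)

@[simp] theorem entry_utThree_00 : entry 0 0 (utThree a b c d e f) = a := rfl
@[simp] theorem entry_utThree_01 : entry 0 1 (utThree a b c d e f) = b := rfl
@[simp] theorem entry_utThree_02 : entry 0 2 (utThree a b c d e f) = c := rfl
@[simp] theorem entry_utThree_11 : entry 1 1 (utThree a b c d e f) = d := rfl
@[simp] theorem entry_utThree_12 : entry 1 2 (utThree a b c d e f) = e := rfl
@[simp] theorem entry_utThree_22 : entry 2 2 (utThree a b c d e f) = f := rfl
@[simp] theorem entry_utTwo_00 : entry 0 0 (utTwo a b c) = a := rfl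
@[simp] theorem entry_utTwo_01 : entry 0 1 (utTwo a b c) = b := rfl
@[simp] theorem entry_utTwo_11 : entry 1 1 (utTwo a b c) = c := rfl

end

theorem mem_almostCanonical {M : UT K 3} {d : ZMod 2} : M ∈ almostCanonical K d ↔
    ∀ i j : Fin 3, unitDegree (1 : ZMod 2) 1 i j ≠ d → entry i j M = 0 :=
  forall₂_congr fun _ _ => not_imp_comm

theorem mem_almostCanonical_zero {M : UT K 3} :
    M ∈ almostCanonical K 0 ↔ entry 0 1 M = 0 ∧ entry 1 2 M = 0 := by
  rw [mem_almostCanonical]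
  refine ⟨fun h => ⟨h 0 1 (by decide), h 1 2 (by decide)⟩, fun ⟨h1, h2⟩ i j hij => ?_⟩
  fin_cases i <;> fin_cases j <;>
    first | assumption | exact absurd (by decide) hij | exact entry_of_lt M (by decide)

theorem mem_almostCanonical_one {M : UT K 3} : M ∈ almostCanonical K 1 ↔
    entry 0 0 M = 0 ∧ entry 1 1 M = 0 ∧ entry 2 2 M = 0 ∧ entry 0 2 M = 0 := by
  rw [mem_almostCanonical]
  refine ⟨fun h => ⟨h 0 0 (by decide), h 1 1 (by decide), h 2 2 (by decide), h 0 2 (by decide)⟩,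
    fun ⟨h1, h2, h3, h4⟩ i j hij => ?_⟩
  fin_cases i <;> fin_cases j <;>
    first | assumption | exact absurd (by decide) hij | exact entry_of_lt M (by decide)

theorem almostCanonical_lie_mem {d e : ZMod 2} {M N : UT K 3} (hM : M ∈ almostCanonical K d)
    (hN : N ∈ almostCanonical K e) : ⁅M, N⁆ ∈ almostCanonical K (d + e) :=
  elementaryGrading_lie_mem 1 1 hM hN

section Eigenvalues

variable {M N : UT K 3}

theorem entry_01_lie (hM : M ∈ almostCanonical K 1) (hN : N ∈ almostCanonical K 0) :
    entry 0 1 ⁅M, N⁆ = entry 0 1 M * (entry 1 1 N - entry 0 0 N) := by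
  rw [mem_almostCanonical_one] at hM
  rw [mem_almostCanonical_zero] at hN
  simp only [entry_lie, Fin.sum_univ_three, hM, hN, entry_three_two_one]
  ring

theorem entry_12_lie (hM : M ∈ almostCanonical K 1) (hN : N ∈ almostCanonical K 0) :
    entry 1 2 ⁅M, N⁆ = entry 1 2 M * (entry 2 2 N - entry 1 1 N) := by
  rw [mem_almostCanonical_one] at hM
  rw [mem_almostCanonical_zero] at hN
  simp only [entry_lie, Fin.sum_univ_three, hM, hN, entry_three_one_zero]
  ring

theorem entry_02_lie (hM : M ∈ almostCanonical K 1) (hN : N ∈ almostCanonical K 1) :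
    entry 0 2 ⁅M, N⁆ = entry 0 1 M * entry 1 2 N - entry 0 1 N * entry 1 2 M := by
  rw [mem_almostCanonical_one] at hM hN
  simp [entry_lie, Fin.sum_univ_three, hM, hN]

theorem lie_mem_one (hM : M ∈ almostCanonical K 1) (hN : N ∈ almostCanonical K 0) :
    ⁅M, N⁆ ∈ almostCanonical K 1 := by
  simpa using almostCanonical_lie_mem hM hN

theorem lieRepeat_mem_one (hM : M ∈ almostCanonical K 1) (hN : N ∈ almostCanonical K 0) (m : ℕ) :
    lieRepeat M N m ∈ almostCanonical K 1 := by
  induction m with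
  | zero => exact hM
  | succ m ih => rw [lieRepeat_succ]; exact lie_mem_one ih hN

theorem entry_01_lieRepeat (hM : M ∈ almostCanonical K 1) (hN : N ∈ almostCanonical K 0) (m : ℕ) :
    entry 0 1 (lieRepeat M N m) = entry 0 1 M * (entry 1 1 N - entry 0 0 N) ^ m := by
  induction m with
  | zero => simp
  | succ m ih =>
    rw [lieRepeat_succ, entry_01_lie (lieRepeat_mem_one hM hN m) hN, ih, pow_succ, mul_assoc]

theorem entry_12_lieRepeat (hM : M ∈ almostCanonical K 1) (hN : N ∈ almostCanonical K 0) (m : ℕ) :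
    entry 1 2 (lieRepeat M N m) = entry 1 2 M * (entry 2 2 N - entry 1 1 N) ^ m := by
  induction m with
  | zero => simp
  | succ m ih =>
    rw [lieRepeat_succ, entry_12_lie (lieRepeat_mem_one hM hN m) hN, ih, pow_succ, mul_assoc]

variable {y : ℕ → UT K 3}

theorem lieMulti_mem_one (hM : M ∈ almostCanonical K 1) (hy : ∀ l, y l ∈ almostCanonical K 0)
    {r : ℕ} (p : Fin r → ℕ) : lieMulti M y p ∈ almostCanonical K 1 := by
  induction r with
  | zero => simpa
  | succ r ih => rw [lieMulti_succ]; exact lieRepeat_mem_one (ih _) (hy r) _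

theorem prod_eq_prod_range (p : ℕ →₀ ℕ) (a : ℕ → K) {r : ℕ} (hr : ∀ l, r ≤ l → p l = 0) :
    (p.prod fun l m => a l ^ m) = ∏ l ∈ Finset.range r, a l ^ p l := by
  refine Finsupp.prod_of_support_subset _ (fun l hl => ?_) _ (by simp)
  rw [Finset.mem_range]
  by_contra h
  exact Finsupp.mem_support_iff.mp hl (hr l (not_lt.mp h))

theorem entry_01_lieMono (hM : M ∈ almostCanonical K 1) (hy : ∀ l, y l ∈ almostCanonical K 0)
    (p : ℕ →₀ ℕ) : entry 0 1 (lieMono M y p) =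
      entry 0 1 M * p.prod fun l m => (entry 1 1 (y l) - entry 0 0 (y l)) ^ m := by
  obtain ⟨r, hr⟩ := exists_bound p
  rw [lieMono_eq_lieMulti _ _ _ hr, prod_eq_prod_range p _ hr]
  clear hr
  induction r with
  | zero => simp
  | succ r ih =>
    rw [lieMulti_succ, entry_01_lieRepeat (lieMulti_mem_one hM hy _) (hy r),
      Finset.prod_range_succ, ← mul_assoc]
    exact congrArg (· * _) ih

theorem entry_12_lieMono (hM : M ∈ almostCanonical K 1) (hy : ∀ l, y l ∈ almostCanonical K 0)
    (p : ℕ →₀ ℕ) : entry 1 2 (lieMono M y p) =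
      entry 1 2 M * p.prod fun l m => (entry 2 2 (y l) - entry 1 1 (y l)) ^ m := by
  obtain ⟨r, hr⟩ := exists_bound p
  rw [lieMono_eq_lieMulti _ _ _ hr, prod_eq_prod_range p _ hr]
  clear hr
  induction r with
  | zero => simp
  | succ r ih =>
    rw [lieMulti_succ, entry_12_lieRepeat (lieMulti_mem_one hM hy _) (hy r),
      Finset.prod_range_succ, ← mul_assoc]
    exact congrArg (· * _) ih

end Eigenvalues

/-! ### The component of degree zero and `UT_2` -/

variable (K)

/-- The component of degree zero of `UT_3^{(-)}`. -/
def evenPart : LieSubalgebra K (UT K 3) :=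
  { almostCanonical K 0 with
    lie_mem' := fun {M N} hM hN => by simpa using almostCanonical_lie_mem hM hN }

/-- The projection of the component of degree zero onto `UT_2^{(-)}` that deletes the second row and
column. -/
def evenCorner : evenPart K →ₗ⁅K⁆ UT K 2 where
  toFun M := utTwo (entry 0 0 M.1) (entry 0 2 M.1) (entry 2 2 M.1)
  map_add' M N := by apply UT.ext_two <;> simp
  map_smul' c M := by apply UT.ext_two <;> simp
  map_lie' {M N} := by
    have hM := mem_almostCanonical_zero.mp M.2
    have hN := mem_almostCanonical_zero.mp N.2
    apply UT.ext_two <;>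
      simp [entry_lie, Fin.sum_univ_three, hM, hN]

/-- The entry in the centre, as a homomorphism into `UT_2^{(-)}` with commutative image. -/
def evenCentre : evenPart K →ₗ⁅K⁆ UT K 2 where
  toFun M := utTwo (entry 1 1 M.1) 0 0
  map_add' M N := by apply UT.ext_two <;> simp
  map_smul' c M := by apply UT.ext_two <;> simp
  map_lie' {M N} := by
    have hM := mem_almostCanonical_zero.mp M.2
    have hN := mem_almostCanonical_zero.mp N.2
    apply UT.ext_two <;>
      simp [entry_lie, Fin.sum_univ_three, hM, hN, mul_comm]

/-- The embedding of `UT_2^{(-)}` into the component of degree zero of `UT_3^{(-)}`, as the matrices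
whose second row and column vanish. -/
def embedCorner : UT K 2 →ₗ⁅K⁆ UT K 3 where
  toFun M := utThree (entry 0 0 M) 0 (entry 0 1 M) 0 0 (entry 1 1 M)
  map_add' M N := by apply UT.ext_three <;> simp
  map_smul' c M := by apply UT.ext_three <;> simp
  map_lie' {M N} := by
    apply UT.ext_three <;>
      simp [entry_lie, Fin.sum_univ_three]

theorem embedCorner_injective : Function.Injective (embedCorner K) := by
  intro M N h
  have h00 := congrArg (entry 0 0) h
  have h02 := congrArg (entry 0 2) h
  have h22 := congrArg (entry 2 2) h
  exact UT.ext_two h00 h02 h22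

/-- The Lie algebra of diagonal matrices in `UT_3^{(-)}`. -/
def diagonalPart : LieSubalgebra K (UT K 3) where
  carrier := {M | entry 0 1 M = 0 ∧ entry 1 2 M = 0 ∧ entry 0 2 M = 0}
  add_mem' hM hN := by simp_all
  zero_mem' := by simp
  smul_mem' c M hM := by simp_all
  lie_mem' {M N} hM hN := by
    simp only [Set.mem_ofPred_eq] at hM hN
    simp [entry_lie, Fin.sum_univ_three, hM, hN]

end Matrices

/-! ### Quotients by ideals -/

section Quotients

variable {K L : Type*} [CommRing K] [LieRing L] [LieAlgebra K L] (I : LieIdeal K L)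

/-- The projection onto the quotient by an ideal, as a homomorphism of Lie algebras. -/
def quotientMk : L →ₗ⁅K⁆ L ⧸ I :=
  { (LieSubmodule.Quotient.mk' I : L →ₗ[K] L ⧸ I) with
    map_lie' := fun {x y} => LieSubmodule.Quotient.mk_bracket I x y }

variable {I}

theorem quotientMk_eq_zero {f : L} : quotientMk I f = 0 ↔ f ∈ I :=
  LieSubmodule.Quotient.mk_eq_zero'

theorem quotientMk_surjective : Function.Surjective (quotientMk I) :=
  Quot.mk_surjective

theorem span_image_mk_eq_top_iff {S : Set L} :
    Submodule.span K ((fun s : L => (LieSubmodule.Quotient.mk s : L ⧸ I)) '' S) = ⊤ ↔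
      ∀ f, ∃ s ∈ Submodule.span K S, f - s ∈ I := by
  change Submodule.span K ((quotientMk I : L →ₗ[K] L ⧸ I) '' S) = ⊤ ↔ _
  rw [← Submodule.map_span, Submodule.eq_top_iff']
  constructor
  · intro h f
    obtain ⟨s, hs, hsf⟩ := h (quotientMk I f)
    refine ⟨s, hs, quotientMk_eq_zero.mp ?_⟩
    rw [map_sub, sub_eq_zero]
    exact hsf.symm
  · intro h x
    obtain ⟨f, rfl⟩ := quotientMk_surjective x
    obtain ⟨s, hs, hsf⟩ := h f
    refine ⟨s, hs, ?_⟩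
    rw [← quotientMk_eq_zero, map_sub, sub_eq_zero] at hsf
    exact hsf.symm

/-- A family is linearly independent modulo an ideal if it has linearly independent images under
some linear map that vanishes on the ideal. -/
theorem linearIndependent_mk {M ι : Type*} [AddCommGroup M] [Module K M] (Ψ : L →ₗ[K] M)
    (hΨ : ∀ f ∈ I, Ψ f = 0) {v : ι → L} (h : LinearIndependent K (Ψ ∘ v)) :
    LinearIndependent K fun k => (LieSubmodule.Quotient.mk (v k) : L ⧸ I) :=
  LinearIndependent.of_comp (Submodule.liftQ I.toSubmodule Ψ hΨ) h

/-- Linear independence of a set modulo an ideal follows from that of any family whose range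
contains the set. -/
theorem linearIndependent_subtype_mk {ι : Type*} {S : Set L} {v : ι → L}
    (h : LinearIndependent K fun k => (LieSubmodule.Quotient.mk (v k) : L ⧸ I))
    (hS : S ⊆ Set.range v) :
    LinearIndependent K fun s : S => (LieSubmodule.Quotient.mk (s : L) : L ⧸ I) := by
  choose k hk using fun s : S => hS s.2
  have hinj : Function.Injective k := fun s t hst => Subtype.ext (by rw [← hk s, ← hk t, hst])
  simpa [Function.comp_def, hk] using h.comp k hinj

theorem map_linearCombination {L' ι : Type*} [LieRing L'] [LieAlgebra K L'] (φ : L →ₗ⁅K⁆ L')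
    (v : ι → L) (c : ι →₀ K) :
    φ (Finsupp.linearCombination K v c) = Finsupp.linearCombination K (fun k => φ (v k)) c :=
  Finsupp.apply_linearCombination K (φ : L →ₗ[K] L') v c

end Quotients

variable (K : Type*) [Field K]

/-! ### The generators are identities -/

theorem isTIdeal_almostCanonical : IsTIdeal (gradedIdentities (almostCanonical K)) :=
  isTIdeal_gradedIdentities almostCanonical_lie_mem

theorem inY_mem_gradedIdentities {g : FreeLieAlgebra K ℕ} (hg : g ∈ identities K (UT K 2)) :
    inY K g ∈ gradedIdentities (almostCanonical K) := by
  rw [mem_identities] at hg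
  rw [mem_gradedIdentities]
  intro σ hσ
  let τ : ℕ → evenPart K := fun i => ⟨σ (i, 0), hσ i 0⟩
  have hστ : (FreeLieAlgebra.lift K σ).comp (inY K) =
      (evenPart K).incl.comp (FreeLieAlgebra.lift K τ) := by
    ext1 i
    simp [inY, yVar, τ]
  have hcomp (φ : evenPart K →ₗ⁅K⁆ UT K 2) : φ (FreeLieAlgebra.lift K τ g) = 0 := by
    have h : φ.comp (FreeLieAlgebra.lift K τ) = FreeLieAlgebra.lift K (φ ∘ τ) := by
      ext1 i
      simp
    rw [← LieHom.comp_apply, h, hg]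
  rw [← LieHom.comp_apply, hστ]
  have h1 := hcomp (evenCorner K)
  have h2 := hcomp (evenCentre K)
  have hz := mem_almostCanonical_zero.mp (FreeLieAlgebra.lift K τ g).2
  have h00 := congrArg (entry 0 0) h1
  have h02 := congrArg (entry 0 1) h1
  have h22 := congrArg (entry 1 1) h1
  have h11 := congrArg (entry 0 0) h2
  rw [map_zero] at h00 h02 h22 h11
  exact UT.ext_three (by rw [map_zero]; exact h00) (by rw [map_zero]; exact hz.1)
    (by rw [map_zero]; exact h02) (by rw [map_zero]; exact h11) (by rw [map_zero]; exact hz.2)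
    (by rw [map_zero]; exact h22)

theorem generators_subset :
    generators K ⊆ (gradedIdentities (almostCanonical K) : Set (FreeGraded K (ZMod 2))) := by
  rintro f (((rfl | rfl) | ⟨g, hg, rfl⟩) | ⟨hK, rfl⟩)
  · refine mem_gradedIdentities.mpr fun σ hσ => ?_
    have h0 := mem_almostCanonical_one.mp (hσ 0 1)
    have h1 := mem_almostCanonical_one.mp (hσ 1 1)
    have h2 := mem_almostCanonical_one.mp (hσ 2 1)
    apply UT.ext_three <;> simp [zVar, entry_lie, Fin.sum_univ_three, h0, h1, h2]
  · refine mem_gradedIdentities.mpr fun σ hσ => ?_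
    have h0 := mem_almostCanonical_zero.mp (hσ 0 0)
    have h1 := mem_almostCanonical_zero.mp (hσ 1 0)
    have h2 := mem_almostCanonical_one.mp (hσ 0 1)
    apply UT.ext_three <;>
      simp only [zVar, yVar, LieHom.map_lie, FreeLieAlgebra.lift_of_apply, map_zero, entry_lie,
        Fin.sum_univ_three, h0, h1, h2, entry_three_one_zero, entry_three_two_zero,
        entry_three_two_one] <;>
      ring
  · exact inY_mem_gradedIdentities K hg
  · refine mem_gradedIdentities.mpr fun σ hσ => ?_
    have := Fintype.ofFinite K
    rw [map_sub, map_lieRepeat, LieHom.map_lie, sub_eq_zero]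
    simp only [zVar, yVar, FreeLieAlgebra.lift_of_apply]
    have hy := hσ 0 0
    have hz := hσ 0 1
    have hl := mem_almostCanonical_one.mp (lieRepeat_mem_one hz hy (Nat.card K))
    have hr := mem_almostCanonical_one.mp (lie_mem_one hz hy)
    apply UT.ext_three
    · rw [hl.1, hr.1]
    · rw [entry_01_lieRepeat hz hy, entry_01_lie hz hy, Nat.card_eq_fintype_card,
        FiniteField.pow_card]
    · rw [hl.2.2.2, hr.2.2.2]
    · rw [hl.2.1, hr.2.1]
    · rw [entry_12_lieRepeat hz hy, entry_12_lie hz hy, Nat.card_eq_fintype_card,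
        FiniteField.pow_card]
    · rw [hl.2.2.1, hr.2.2.1]

theorem tIdealSpan_generators_le :
    tIdealSpan (generators K) ≤ gradedIdentities (almostCanonical K) :=
  tIdealSpan_le (isTIdeal_almostCanonical K) (generators_subset K)

/-! ### Reduction modulo the generators -/

variable {K} in
/-- Elements of degree zero and one may be substituted for the variables in an element of a
`T`-ideal. -/
theorem lift_mem_tIdealSpan {f : FreeGraded K (ZMod 2)} (hf : f ∈ generators K)
    {a b : ℕ → FreeGraded K (ZMod 2)} (ha : ∀ i, a i ∈ freeComponent K (0 : ZMod 2))
    (hb : ∀ i, b i ∈ freeComponent K (1 : ZMod 2)) :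
    FreeLieAlgebra.lift K (fun x : ℕ × ZMod 2 => if x.2 = 0 then a x.1 else b x.1) f ∈
      tIdealSpan (generators K) := by
  refine isTIdeal_tIdealSpan _ _ (fun i g => ?_) f (subset_tIdealSpan _ hf)
  rw [FreeLieAlgebra.lift_of_apply]
  fin_cases g
  · exact ha i
  · exact hb i

theorem oddRelations_quotient :
    OddRelations K (quotientMk (tIdealSpan (generators K)) ∘ yVar K)
      (quotientMk (tIdealSpan (generators K)) ∘ zVar K)
      (quotientMk (tIdealSpan (generators K)) '' freeComponent K (1 : ZMod 2)) where
  mem i := ⟨zVar K i, of_mem_freeComponent i 1, rfl⟩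
  lie_mem := by
    rintro _ ⟨u, hu, rfl⟩ l
    refine ⟨⁅u, yVar K l⁆, ?_, LieHom.map_lie _ _ _⟩
    have h := lie_mem_freeComponent hu (of_mem_freeComponent (K := K) l (0 : ZMod 2))
    rwa [add_zero] at h
  nilpotent := by
    rintro _ _ _ ⟨u, hu, rfl⟩ ⟨v, hv, rfl⟩ ⟨w, hw, rfl⟩
    have h := lift_mem_tIdealSpan (K := K) (Or.inl (Or.inl (Or.inl rfl))) (a := fun _ => 0)
      (b := fun i => if i = 0 then u else if i = 1 then v else w) (fun _ => Submodule.zero_mem _)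
      (fun i => by split_ifs <;> assumption)
    rw [← LieHom.map_lie, ← LieHom.map_lie, quotientMk_eq_zero]
    simpa [zVar] using h
  lie_comm := by
    rintro _ ⟨u, hu, rfl⟩ k l
    have h := lift_mem_tIdealSpan (K := K) (Or.inl (Or.inl (Or.inr rfl)))
      (a := fun i => if i = 0 then yVar K k else yVar K l) (b := fun _ => u)
      (fun i => by split_ifs <;> exact of_mem_freeComponent _ _) (fun _ => hu)
    have h' : quotientMk (tIdealSpan (generators K)) ⁅⁅yVar K k, yVar K l⁆, u⁆ = 0 := by
      rw [quotientMk_eq_zero]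
      simpa [zVar, yVar] using h
    rw [LieHom.map_lie, LieHom.map_lie, ← lie_skew, neg_eq_zero, leibniz_lie] at h'
    have h2 := eq_neg_of_add_eq_zero_left h'
    rw [lie_skew] at h2
    exact h2
  frobenius := by
    rintro hK _ ⟨u, hu, rfl⟩ l
    have h := lift_mem_tIdealSpan (K := K) (Or.inr ⟨hK, rfl⟩)
      (a := fun _ => yVar K l) (b := fun _ => u) (fun i => of_mem_freeComponent _ _) (fun _ => hu)
    rw [← sub_eq_zero, Function.comp_apply, ← map_lieRepeat, ← LieHom.map_lie, ← map_sub,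
      quotientMk_eq_zero]
    rw [map_sub, map_lieRepeat, LieHom.map_lie] at h
    simpa [zVar, yVar] using h

/-- Modulo the generators, every element is the sum of a polynomial in the variables of degree zero
and of linear combinations of reduced commutators and of their brackets. -/
theorem exists_decomposition (f : FreeGraded K (ZMod 2)) :
    ∃ (g : FreeLieAlgebra K ℕ) (c : CommIndex K →₀ K) (d : PairIndex K →₀ K),
      f - (inY K g + (Finsupp.linearCombination K (comm (yVar K) (zVar K)) c +
        Finsupp.linearCombination K (pairComm (yVar K) (zVar K)) d)) ∈
          tIdealSpan (generators K) := by
  have hgen : ∀ N : LieSubalgebra K (FreeGraded K (ZMod 2) ⧸ tIdealSpan (generators K)),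
      (∀ i, (quotientMk (tIdealSpan (generators K)) ∘ yVar K) i ∈ N) →
      (∀ i, (quotientMk (tIdealSpan (generators K)) ∘ zVar K) i ∈ N) → N = ⊤ := by
    intro N hy hz
    rw [eq_top_iff]
    rintro x -
    obtain ⟨f, rfl⟩ := quotientMk_surjective x
    rw [← FreeLieAlgebra.lift_comp_of (quotientMk (tIdealSpan (generators K)))]
    refine lift_mem N (fun ⟨i, g⟩ => ?_) f
    fin_cases g
    · exact hy i
    · exact hz i
  have hf := (oddRelations_quotient K).span_eq_top hgen ▸
    Submodule.mem_top (x := quotientMk (tIdealSpan (generators K)) f)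
  obtain ⟨_, ⟨g, rfl⟩, w, hw, hf⟩ := Submodule.mem_sup.mp hf
  obtain ⟨u, hu, v, hv, rfl⟩ := Submodule.mem_sup.mp hw
  rw [← Finsupp.range_linearCombination] at hu hv
  obtain ⟨c, rfl⟩ := hu
  obtain ⟨d, rfl⟩ := hv
  refine ⟨g, c, d, ?_⟩
  have hY : (quotientMk (tIdealSpan (generators K))).comp (inY K) =
      FreeLieAlgebra.lift K (quotientMk (tIdealSpan (generators K)) ∘ yVar K) := by
    ext1 i
    simp [inY]
  have hY' := LieHom.congr_fun hY g
  rw [LieHom.comp_apply] at hY'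
  rw [← quotientMk_eq_zero, map_sub, map_add, map_add, sub_eq_zero, ← hf, hY',
    map_linearCombination, map_linearCombination, funext (map_comm _ _ _),
    funext (map_pairComm _ _ _)]
  rfl

/-! ### Separation by evaluations -/

/-- The homomorphism onto the free Lie algebra in the variables of degree zero that annihilates the
variables of degree one. -/
def killOdd : FreeGraded K (ZMod 2) →ₗ⁅K⁆ FreeLieAlgebra K ℕ :=
  FreeLieAlgebra.lift K fun x => if x.2 = 0 then FreeLieAlgebra.of K x.1 else 0

theorem killOdd_inY (g : FreeLieAlgebra K ℕ) : killOdd K (inY K g) = g := by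
  have h : (killOdd K).comp (inY K) = LieHom.id := by
    ext1 i
    simp [killOdd, inY, yVar]
  exact LieHom.congr_fun h g

theorem lieMono_zero_left {L : Type*} [LieRing L] (y : ℕ → L) (p : ℕ →₀ ℕ) :
    lieMono 0 y p = 0 := by
  have hrep (x : L) (m : ℕ) : lieRepeat 0 x m = 0 := by
    induction m with
    | zero => rfl
    | succ m ih => rw [lieRepeat_succ, ih, zero_lie]
  obtain ⟨r, hr⟩ := exists_bound p
  rw [lieMono_eq_lieMulti _ _ _ hr]
  clear hr
  induction r with
  | zero => simp
  | succ r ih =>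
    rw [lieMulti_succ]
    simp only [Fin.val_castSucc]
    rw [ih, hrep]

theorem killOdd_comm (u : CommIndex K) : killOdd K (comm (yVar K) (zVar K) u) = 0 := by
  have hz (i : ℕ) : killOdd K (zVar K i) = 0 := by simp [killOdd, zVar]
  rw [comm, map_lieMono, hz, lieMono_zero_left]

theorem killOdd_pairComm (w : PairIndex K) : killOdd K (pairComm (yVar K) (zVar K) w) = 0 := by
  rw [pairComm, LieHom.map_lie, killOdd_comm, zero_lie]

theorem killOdd_mem_identities {f : FreeGraded K (ZMod 2)}
    (hf : f ∈ gradedIdentities (almostCanonical K)) : killOdd K f ∈ identities K (UT K 2) := by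
  rw [mem_gradedIdentities] at hf
  rw [mem_identities]
  intro τ
  apply embedCorner_injective K
  have h : (embedCorner K).comp ((FreeLieAlgebra.lift K τ).comp (killOdd K)) =
      FreeLieAlgebra.lift K fun x => if x.2 = 0 then embedCorner K (τ x.1) else 0 := by
    ext1 x
    simp only [LieHom.comp_apply, killOdd, FreeLieAlgebra.lift_of_apply]
    split_ifs <;> simp
  rw [map_zero, ← hf _ fun i g => ?_, ← h]
  · rfl
  · dsimp only
    split_ifs with hg
    · rw [hg]
      exact mem_almostCanonical_zero.mpr ⟨rfl, rfl⟩
    · exact Submodule.zero_mem _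

variable {K}

/-- The substitution of diagonal matrices for the `y_l` and of elements of degree one for the `z_i`
whose coordinates are given by two points `(x, a)` and `(x', a')`: on `e_{12}`, bracketing with
`y_l` is multiplication by `a_l`, and on `e_{23}` by `a'_l`. -/
def pointSubst (c : ((ℕ → K) × (ℕ → K)) × ((ℕ → K) × (ℕ → K))) (x : ℕ × ZMod 2) : UT K 3 :=
  if x.2 = 0 then utThree (-c.1.2 x.1) 0 0 0 0 (c.2.2 x.1)
  else utThree 0 (c.1.1 x.1) 0 0 (c.2.1 x.1) 0

section PointSubst

variable (c : ((ℕ → K) × (ℕ → K)) × ((ℕ → K) × (ℕ → K)))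

theorem pointSubst_mem (i : ℕ) (g : ZMod 2) : pointSubst c (i, g) ∈ almostCanonical K g := by
  fin_cases g
  · exact mem_almostCanonical_zero.mpr ⟨rfl, rfl⟩
  · exact mem_almostCanonical_one.mpr ⟨rfl, rfl, rfl, rfl⟩

theorem lift_pointSubst_comm (u : CommIndex K) :
    FreeLieAlgebra.lift K (pointSubst c) (comm (yVar K) (zVar K) u) =
      lieMono (pointSubst c ((ofLex u).1, 1)) (fun l => pointSubst c (l, 0))
        (ofLex ((ofLex u).2 : Lex (ℕ →₀ ℕ))) := by
  rw [comm, map_lieMono]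
  congr 1
  · simp [zVar]
  · funext l
    simp [yVar]

theorem lift_pointSubst_comm_mem (u : CommIndex K) :
    FreeLieAlgebra.lift K (pointSubst c) (comm (yVar K) (zVar K) u) ∈ almostCanonical K 1 := by
  rw [lift_pointSubst_comm]
  exact lieMulti_mem_one (pointSubst_mem c _ _) (fun l => pointSubst_mem c l 0) _

theorem entry_01_comm (u : CommIndex K) :
    entry 0 1 (FreeLieAlgebra.lift K (pointSubst c) (comm (yVar K) (zVar K) u)) =
      commValue u c.1 := by
  rw [lift_pointSubst_comm, entry_01_lieMono (pointSubst_mem c _ _) fun l => pointSubst_mem c l 0]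
  simp [pointSubst, commValue]

theorem entry_12_comm (u : CommIndex K) :
    entry 1 2 (FreeLieAlgebra.lift K (pointSubst c) (comm (yVar K) (zVar K) u)) =
      commValue u c.2 := by
  rw [lift_pointSubst_comm, entry_12_lieMono (pointSubst_mem c _ _) fun l => pointSubst_mem c l 0]
  simp [pointSubst, commValue]

theorem entry_02_comm (u : CommIndex K) :
    entry 0 2 (FreeLieAlgebra.lift K (pointSubst c) (comm (yVar K) (zVar K) u)) = 0 :=
  (mem_almostCanonical_one.mp (lift_pointSubst_comm_mem c u)).2.2.2

theorem entry_01_pairComm (w : PairIndex K) :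
    entry 0 1 (FreeLieAlgebra.lift K (pointSubst c) (pairComm (yVar K) (zVar K) w)) = 0 := by
  rw [pairComm, LieHom.map_lie]
  exact (mem_almostCanonical_zero.mp (almostCanonical_lie_mem (lift_pointSubst_comm_mem c w.1.1)
    (lift_pointSubst_comm_mem c w.1.2))).1

theorem entry_02_pairComm (w : PairIndex K) :
    entry 0 2 (FreeLieAlgebra.lift K (pointSubst c) (pairComm (yVar K) (zVar K) w)) =
      pairValue w c := by
  rw [pairComm, LieHom.map_lie, entry_02_lie (lift_pointSubst_comm_mem c w.1.1)
    (lift_pointSubst_comm_mem c w.1.2)]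
  simp only [entry_01_comm, entry_12_comm]
  rfl

theorem lift_pointSubst_inY (g : FreeLieAlgebra K ℕ) :
    FreeLieAlgebra.lift K (pointSubst c) (inY K g) ∈ diagonalPart K := by
  have h : (FreeLieAlgebra.lift K (pointSubst c)).comp (inY K) =
      FreeLieAlgebra.lift K fun l => pointSubst c (l, 0) := by
    ext1 l
    simp [inY, yVar]
  rw [← LieHom.comp_apply, h]
  exact lift_mem (diagonalPart K) (fun l => ⟨rfl, rfl, rfl⟩) g

end PointSubst

variable (K)

/-- The coefficients of `e_{12}` under the substitutions `pointSubst` with both points equal. -/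
def linearValues : FreeGraded K (ZMod 2) →ₗ[K] ((ℕ → K) × (ℕ → K) → K) :=
  LinearMap.pi fun c => entry 0 1 ∘ₗ
    (FreeLieAlgebra.lift K (pointSubst (c, c)) : FreeGraded K (ZMod 2) →ₗ[K] UT K 3)

/-- The coefficients of `e_{13}` under the substitutions `pointSubst`. -/
def quadraticValues :
    FreeGraded K (ZMod 2) →ₗ[K] (((ℕ → K) × (ℕ → K)) × ((ℕ → K) × (ℕ → K)) → K) :=
  LinearMap.pi fun c => entry 0 2 ∘ₗ
    (FreeLieAlgebra.lift K (pointSubst c) : FreeGraded K (ZMod 2) →ₗ[K] UT K 3)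

/-- The joint linear map that separates the three types of basis elements: the part in the variables
of degree zero, modulo the identities of `UT_2^{(-)}`, and the values of the coefficients of
`e_{12}` and of `e_{13}`. -/
def separation : FreeGraded K (ZMod 2) →ₗ[K]
    (FreeLieAlgebra K ℕ ⧸ identities K (UT K 2)) × ((ℕ → K) × (ℕ → K) → K) ×
      (((ℕ → K) × (ℕ → K)) × ((ℕ → K) × (ℕ → K)) → K) :=
  (((quotientMk (identities K (UT K 2))).comp (killOdd K) : _ →ₗ⁅K⁆ _) : _ →ₗ[K] _).prod
    ((linearValues K).prod (quadraticValues K))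

theorem separation_eq_zero {f : FreeGraded K (ZMod 2)}
    (hf : f ∈ gradedIdentities (almostCanonical K)) : separation K f = 0 := by
  have h := mem_gradedIdentities.mp hf
  refine Prod.ext (quotientMk_eq_zero.mpr (killOdd_mem_identities K hf))
    (Prod.ext (funext fun c => ?_) (funext fun c => ?_))
  · exact (congrArg (entry 0 1) (h _ (pointSubst_mem (c, c)))).trans (map_zero _)
  · exact (congrArg (entry 0 2) (h _ (pointSubst_mem c))).trans (map_zero _)

theorem separation_inY (g : FreeLieAlgebra K ℕ) :
    separation K (inY K g) = (quotientMk (identities K (UT K 2)) g, 0, 0) := by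
  refine Prod.ext ?_ (Prod.ext (funext fun c => ?_) (funext fun c => ?_))
  · exact congrArg (quotientMk (identities K (UT K 2))) (killOdd_inY K g)
  · exact (lift_pointSubst_inY (c, c) g).1
  · exact (lift_pointSubst_inY c g).2.2

theorem separation_comm (u : CommIndex K) :
    separation K (comm (yVar K) (zVar K) u) = (0, commValue u, 0) := by
  refine Prod.ext ?_ (Prod.ext (funext fun c => ?_) (funext fun c => ?_))
  · exact (congrArg (quotientMk (identities K (UT K 2))) (killOdd_comm K u)).trans (map_zero _)
  · exact entry_01_comm (c, c) u
  · exact entry_02_comm c u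

theorem separation_pairComm (w : PairIndex K) :
    separation K (pairComm (yVar K) (zVar K) w) = (0, 0, pairValue w) := by
  refine Prod.ext ?_ (Prod.ext (funext fun c => ?_) (funext fun c => ?_))
  · exact (congrArg (quotientMk (identities K (UT K 2))) (killOdd_pairComm K w)).trans (map_zero _)
  · exact entry_01_pairComm (c, c) w
  · exact entry_02_pairComm c w

/-- An element in the normal form of `exists_decomposition` is a graded identity only if its part
in `𝓛(Y)` is an identity of `UT_2^{(-)}` and all other coefficients vanish. -/
theorem decomposition_unique {g : FreeLieAlgebra K ℕ} {c : CommIndex K →₀ K} {d : PairIndex K →₀ K}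
    (h : inY K g + (Finsupp.linearCombination K (comm (yVar K) (zVar K)) c +
      Finsupp.linearCombination K (pairComm (yVar K) (zVar K)) d) ∈
        gradedIdentities (almostCanonical K)) :
    g ∈ identities K (UT K 2) ∧ c = 0 ∧ d = 0 := by
  have hc : separation K (Finsupp.linearCombination K (comm (yVar K) (zVar K)) c) =
      (0, Finsupp.linearCombination K commValue c, 0) := by
    rw [Finsupp.apply_linearCombination, Function.comp_def, funext (separation_comm K)]
    exact (Finsupp.apply_linearCombination K (LinearMap.inr K _ _ ∘ₗ LinearMap.inl K _ _)
      commValue c).symm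
  have hd : separation K (Finsupp.linearCombination K (pairComm (yVar K) (zVar K)) d) =
      (0, 0, Finsupp.linearCombination K pairValue d) := by
    rw [Finsupp.apply_linearCombination, Function.comp_def, funext (separation_pairComm K)]
    exact (Finsupp.apply_linearCombination K (LinearMap.inr K _ _ ∘ₗ LinearMap.inr K _ _)
      pairValue d).symm
  have hs := separation_eq_zero K h
  rw [map_add, map_add, separation_inY, hc, hd] at hs
  simp only [Prod.mk_add_mk, add_zero, zero_add, Prod.mk_eq_zero] at hs
  exact ⟨quotientMk_eq_zero.mp hs.1,
    linearIndependent_iff.mp (linearIndependent_commValue K) c hs.2.1,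
    linearIndependent_iff.mp (linearIndependent_pairValue K) d hs.2.2⟩

theorem gradedIdentities_eq :
    gradedIdentities (almostCanonical K) = tIdealSpan (generators K) := by
  refine le_antisymm (fun f hf => ?_) (tIdealSpan_generators_le K)
  obtain ⟨g, c, d, hT⟩ := exists_decomposition K f
  obtain ⟨hg, rfl, rfl⟩ := decomposition_unique K (g := g) (c := c) (d := d) (by
    have := sub_mem hf (tIdealSpan_generators_le K hT)
    rwa [sub_sub_cancel] at this)
  have hY : inY K g ∈ tIdealSpan (generators K) :=
    subset_tIdealSpan _ (Or.inl (Or.inr ⟨g, hg, rfl⟩))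
  simpa using add_mem hT hY

theorem isBasisModulo_gradedIdentities {B : Set (FreeLieAlgebra K ℕ)}
    (hB : IsBasisModulo (identities K (UT K 2)) B) :
    IsBasisModulo (gradedIdentities (almostCanonical K))
      (inY K '' B ∪ linearPolys K ∪ quadraticPolys K) := by
  rw [← range_comm, ← range_pairComm]
  constructor
  · refine linearIndependent_subtype_mk (v := Sum.elim (fun b : B => inY K b)
      (Sum.elim (comm (K := K) (yVar K) (zVar K)) (pairComm (K := K) (yVar K) (zVar K))))
      (linearIndependent_mk (separation K) (fun f hf => separation_eq_zero K hf) ?_) ?_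
    · have h := linearIndependent_inl_union_inr' hB.1
        (linearIndependent_inl_union_inr' (linearIndependent_commValue K)
          (linearIndependent_pairValue K))
      convert h using 1
      · funext k
        rcases k with b | u | w
        · exact separation_inY K b
        · exact separation_comm K u
        · exact separation_pairComm K w
      · rfl
    · rw [Set.Sum.elim_range, Set.Sum.elim_range, ← Set.union_assoc, Set.image_eq_range]
  · rw [span_image_mk_eq_top_iff]
    intro f
    obtain ⟨g, c, d, hT⟩ := exists_decomposition K f
    obtain ⟨b, hb, hgb⟩ := span_image_mk_eq_top_iff.mp hB.2 g
    refine ⟨inY K b + (Finsupp.linearCombination K (comm (yVar K) (zVar K)) c +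
        Finsupp.linearCombination K (pairComm (yVar K) (zVar K)) d), ?_, ?_⟩
    · rw [Submodule.span_union, Submodule.span_union, sup_assoc]
      refine Submodule.add_mem_sup ?_ (Submodule.add_mem_sup ?_ ?_)
      · have h := Submodule.mem_map_of_mem
          (f := (inY K : FreeLieAlgebra K ℕ →ₗ[K] FreeGraded K (ZMod 2))) hb
        rwa [Submodule.map_span] at h
      · exact Finsupp.mem_span_range_iff_exists_finsupp.mpr ⟨c, rfl⟩
      · exact Finsupp.mem_span_range_iff_exists_finsupp.mpr ⟨d, rfl⟩
    · have h := add_mem (tIdealSpan_generators_le K hT) (inY_mem_gradedIdentities K hgb)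
      rw [map_sub] at h
      convert h using 1
      abel

end

end GradedLiePI

open GradedLiePI in
theorem mainTheorem3 (K : Type*) [Field K] :
    gradedIdentities (almostCanonical K) = tIdealSpan (generators K) ∧
    ∀ B : Set (FreeLieAlgebra K ℕ), IsBasisModulo (identities K (UT K 2)) B →
      IsBasisModulo (gradedIdentities (almostCanonical K))
        (inY K '' B ∪ linearPolys K ∪ quadraticPolys K) :=
  ⟨gradedIdentities_eq K, fun _ hB => isBasisModulo_gradedIdentities K hB⟩
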